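/- Let $\mathbb{D}^2$ be the open unit bidisk, $\mathbb{T}^2$ the two-torus, and $H^2(\mathbb{D}^2)$ the Hardy space of the bidisk, i.e. the Hilbert space of power series $\sum_{j,k\ge 0} a_{jk}z_1^jz_2^k$ with $\sum|a_{jk}|^2<\infty$. Let $\Theta$ be a rational inner function on $\mathbb{D}^2$: $\Theta$ is bounded and holomorphic on $\mathbb{D}^2$, its radial boundary values have modulus $1$ at almost every point of $\mathbb{T}^2$, and $\Theta=q/p$ on $\mathbb{D}^2$ for polynomials $p,q$ with no common factors, $p$ having no zeros on $\mathbb{D}^2$. Let $(m,n)$ be the degree of $\Theta$, i.e. $m$ (resp. $n$) is the highest degree of $z_1$ (resp. $z_2$) appearing in $p$ or $q$. Let $\mathcal{K}_\Theta=H^2(\mathbb{D}^2)\ominus\Theta H^2(\mathbb{D}^2)$, and let $\mathcal{K}_\Theta=\mathcal{S}_1\oplus\mathcal{S}_2$ be any orthogonal decomposition into closed subspaces such that $\mathcal{S}_1$ is invariant under multiplication by $z_1$ and $\mathcal{S}_2$ is invariant under multiplication by $z_2$. Let $$S^1_\Theta = P_{\mathcal{S}_2}M_{z_1}|_{\mathcal{S}_2}$$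 be the compression to $\mathcal{S}_2$ of multiplication by $z_1$, and let $$w(S^1_\Theta)=\sup\{|\langle S^1_\Theta h,h\rangle| : h\in\mathcal{S}_2,\ \|h\|=1\}$$ be its numerical radius (with $w=0$ if $\mathcal{S}_2=\{0\}$). Then $w(S^1_\Theta)=1$ if and only if $\Theta$ has a singularity on $\mathbb{T}^2$, i.e. there is a point $\tau\in\mathbb{T}^2$ such that $\Theta$ does not extend holomorphically to a neighborhood of $\tau$. -/

import Mathlib

open Filter Topology MeasureTheory

noncomputable section

namespace BidiskShift

/-- The open unit bidisk `𝔻²` in `ℂ²`. -/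
def bidisk : Set (Fin 2 → ℂ) := {z | ∀ i, ‖z i‖ < 1}

/-- The two-torus `𝕋²` (the distinguished boundary of the bidisk). -/
def torus : Set (Fin 2 → ℂ) := {z | ∀ i, ‖z i‖ = 1}

/-! ### The Hardy space of the bidisk -/

/-- The Hardy space `H²(𝔻²)`: power series `∑ a_{jk} z₁^j z₂^k` with square-summable coefficients,
with the inner product of the coefficient sequences. An element is its coefficient family; the
holomorphic function that it represents is `H2.value`. -/
abbrev H2 : Type := lp (fun _ : ℕ × ℕ => ℂ) 2

/-- The value at `z` of the function represented by `f`. -/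
def H2.value (f : H2) (z : Fin 2 → ℂ) : ℂ :=
  ∑' a : ℕ × ℕ, f a * (z 0 ^ a.1 * z 1 ^ a.2)

/-- On the bidisk the power series converges absolutely. -/
theorem H2.summable_value (f : H2) {z : Fin 2 → ℂ} (hz : z ∈ bidisk) :
    Summable fun a : ℕ × ℕ => f a * (z 0 ^ a.1 * z 1 ^ a.2) := by
  have h : Summable fun a : ℕ × ℕ => ‖z 0‖ ^ a.1 * ‖z 1‖ ^ a.2 :=
    (summable_geometric_of_lt_one (norm_nonneg _) (hz 0)).mul_of_nonneg
      (summable_geometric_of_lt_one (norm_nonneg _) (hz 1))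
      (fun _ => by positivity) (fun _ => by positivity)
  refine Summable.of_norm_bounded (h.mul_left ‖f‖) fun a => ?_
  rw [norm_mul, norm_mul, norm_pow, norm_pow]
  gcongr
  exact lp.norm_apply_le_norm (by norm_num) f a

/-- Multiplication by the monomial `z₁^{d.1} z₂^{d.2}` on `H²(𝔻²)`, which shifts the coefficients
by `d`, as an isometry. -/
def mulMonomial (d : ℕ × ℕ) : H2 →ₗᵢ[ℂ] H2 :=
  have hinj : Function.Injective fun a : ℕ × ℕ => a + d := add_left_injective d
  have hval (f : H2) (a : ℕ × ℕ) :
      (fun b : ℕ × ℕ => if d ≤ b then f (b - d) else 0) (a + d) = f a := by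
    have h : d ≤ a + d := ⟨Nat.le_add_left _ _, Nat.le_add_left _ _⟩
    have h' : a + d - d = a := by ext <;> simp
    simp only [h, h', if_true]
  have hout (f : H2) (b : ℕ × ℕ) (hb : b ∉ Set.range fun a : ℕ × ℕ => a + d) :
      (if d ≤ b then f (b - d) else 0) = 0 := by
    refine if_neg fun h => hb ⟨b - d, ?_⟩
    ext
    · exact Nat.sub_add_cancel h.1
    · exact Nat.sub_add_cancel h.2
  have hmem (f : H2) : Memℓp (fun b : ℕ × ℕ => if d ≤ b then f (b - d) else 0) 2 := by
    refine memℓp_gen ((hinj.summable_iff fun b hb => ?_).1 ?_)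
    · rw [hout f b hb]; simp
    · refine ((lp.memℓp f).summable (by norm_num)).congr fun a => ?_
      exact congrArg (fun x : ℂ => ‖x‖ ^ (2 : ENNReal).toReal) (hval f a).symm
  { toFun f := ⟨fun b => if d ≤ b then f (b - d) else 0, hmem f⟩
    map_add' f g := by
      ext b
      change (if d ≤ b then (f + g) (b - d) else 0 : ℂ) =
        (if d ≤ b then f (b - d) else 0) + (if d ≤ b then g (b - d) else 0)
      by_cases h : d ≤ b <;> simp [h]
    map_smul' c f := by
      ext b
      by_cases h : d ≤ b <;> simp [h]
    norm_map' f := by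
      have h2 : 0 < (2 : ENNReal).toReal := by norm_num
      rw [lp.norm_eq_tsum_rpow h2, lp.norm_eq_tsum_rpow h2]
      congr 1
      refine (hinj.tsum_eq ?_).symm.trans (tsum_congr fun a => ?_)
      · intro b hb
        by_contra hb'
        refine hb ?_
        change ‖(if d ≤ b then f (b - d) else 0 : ℂ)‖ ^ (2 : ENNReal).toReal = 0
        rw [hout f b hb']; simp
      · exact congrArg (fun x : ℂ => ‖x‖ ^ (2 : ENNReal).toReal) (hval f a) }

/-- The shift `M_{z₁}`: multiplication by `z₁` on `H²(𝔻²)`. -/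
def Mz1 : H2 →ₗᵢ[ℂ] H2 := mulMonomial (1, 0)

/-- The shift `M_{z₂}`: multiplication by `z₂` on `H²(𝔻²)`. -/
def Mz2 : H2 →ₗᵢ[ℂ] H2 := mulMonomial (0, 1)

/-! ### Rational inner functions -/

/-- `Θ` is inner on the bidisk: bounded and holomorphic, with radial boundary values of modulus one
at almost every point `(e^{i t₁}, e^{i t₂})` of the torus. -/
structure IsInner (Θ : (Fin 2 → ℂ) → ℂ) : Prop where
  holomorphic : DifferentiableOn ℂ Θ bidisk
  bounded : ∃ C : ℝ, ∀ z ∈ bidisk, ‖Θ z‖ ≤ C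
  boundary : ∀ᵐ t : Fin 2 → ℝ, ∃ b : ℂ, ‖b‖ = 1 ∧
    Tendsto (fun r : ℝ => Θ fun i => (r : ℂ) * Complex.exp (Complex.I * (t i : ℂ)))
      (𝓝[<] 1) (𝓝 b)

/-- `Θ` is (on the bidisk) a rational function of degree `(m, n)`: it is a quotient `q / p` of
polynomials without common factors, `m` is the highest degree of `z₁` and `n` the highest degree
of `z₂` that appears in `p` or `q`. -/
def IsRationalOfDegree (Θ : (Fin 2 → ℂ) → ℂ) (m n : ℕ) : Prop :=
  ∃ p q : MvPolynomial (Fin 2) ℂ, IsRelPrime p q ∧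
    (∀ z ∈ bidisk, MvPolynomial.eval z p ≠ 0 ∧
      Θ z = MvPolynomial.eval z q / MvPolynomial.eval z p) ∧
    max (p.degreeOf 0) (q.degreeOf 0) = m ∧ max (p.degreeOf 1) (q.degreeOf 1) = n

/-- The function `Θ` on the bidisk has a singularity at the point `τ`: it does not extend
holomorphically to a neighborhood of `τ`. -/
def HasSingularityAt (Θ : (Fin 2 → ℂ) → ℂ) (τ : Fin 2 → ℂ) : Prop :=
  ¬ ∃ F : (Fin 2 → ℂ) → ℂ, AnalyticAt ℂ F τ ∧ ∀ᶠ z in 𝓝[bidisk] τ, F z = Θ z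

/-! ### The model space and its shift-invariant decompositions -/

/-- The subspace `Θ H²(𝔻²)` of the Hardy space: those `g` with `g = Θ f` on the bidisk for some
`f` in `H²(𝔻²)`. -/
def rangeMul (Θ : (Fin 2 → ℂ) → ℂ) : Submodule ℂ H2 where
  carrier := {g | ∃ f : H2, ∀ z ∈ bidisk, g.value z = Θ z * f.value z}
  zero_mem' := ⟨0, fun z _ => by simp [H2.value]⟩
  add_mem' := by
    rintro g₁ g₂ ⟨f₁, h₁⟩ ⟨f₂, h₂⟩
    have hadd (f g : H2) (z : Fin 2 → ℂ) (hz : z ∈ bidisk) :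
        (f + g).value z = f.value z + g.value z := by
      simp only [H2.value, lp.coeFn_add, Pi.add_apply, add_mul]
      exact (f.summable_value hz).tsum_add (g.summable_value hz)
    refine ⟨f₁ + f₂, fun z hz => ?_⟩
    rw [hadd _ _ z hz, hadd _ _ z hz, h₁ z hz, h₂ z hz, mul_add]
  smul_mem' := by
    rintro c g ⟨f, h⟩
    have hsmul (f : H2) (z : Fin 2 → ℂ) : (c • f).value z = c * f.value z := by
      simp only [H2.value, lp.coeFn_smul, Pi.smul_apply, smul_eq_mul, mul_assoc]
      exact tsum_mul_left
    refine ⟨c • f, fun z hz => ?_⟩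
    rw [hsmul, hsmul, h z hz]
    ring

/-- The two-variable model space `K_Θ = H²(𝔻²) ⊖ Θ H²(𝔻²)`. -/
def modelSpace (Θ : (Fin 2 → ℂ) → ℂ) : Submodule ℂ H2 := (rangeMul Θ)ᗮ

/-- `K_Θ = S₁ ⊕ S₂` (orthogonal sum of closed subspaces) with `S₁` invariant under `M_{z₁}` and
`S₂` invariant under `M_{z₂}`. -/
structure IsShiftDecomposition (Θ : (Fin 2 → ℂ) → ℂ) (S₁ S₂ : Submodule ℂ H2) : Prop where
  isClosed₁ : IsClosed (S₁ : Set H2)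
  isClosed₂ : IsClosed (S₂ : Set H2)
  orthogonal : S₁ ⟂ S₂
  sup_eq : S₁ ⊔ S₂ = modelSpace Θ
  invariant₁ : ∀ f ∈ S₁, Mz1 f ∈ S₁
  invariant₂ : ∀ f ∈ S₂, Mz2 f ∈ S₂

/-- The compression `P_S M_{z₁}|_S` of the shift `M_{z₁}` to a (closed) subspace `S`. -/
def compressedShift (S : Submodule ℂ H2) [S.HasOrthogonalProjection] : S →L[ℂ] S :=
  S.orthogonalProjectionOnto ∘L Mz1.toContinuousLinearMap ∘L S.subtypeL

/-! ### Numerical range and numerical radius -/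

section Numerical

variable {E : Type*} [NormedAddCommGroup E] [InnerProductSpace ℂ E]

/-- The numerical range `{⟨T h, h⟩ : ‖h‖ = 1}` of a bounded operator. (Mathlib's inner product is
conjugate-linear in its first argument.) -/
def numericalRange (T : E →L[ℂ] E) : Set ℂ :=
  {c | ∃ h : E, ‖h‖ = 1 ∧ c = inner ℂ h (T h)}

/-- The numerical radius `sup {|c| : c ∈ W(T)}` of a bounded operator (it is `0` if the space
is zero). -/
def numericalRadius (T : E →L[ℂ] E) : ℝ :=
  sSup ((fun c : ℂ => ‖c‖) '' numericalRange T)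

end Numerical

end BidiskShift

end

noncomputable section

namespace BidiskShift

open ComplexConjugate

/-! ### Monomial shifts and their adjoints -/

theorem mulMonomial_apply (d : ℕ × ℕ) (f : H2) (b : ℕ × ℕ) :
    mulMonomial d f b = if d ≤ b then f (b - d) else 0 := rfl

theorem H2.apply_congr (f : H2) {a b : ℕ × ℕ} (h₁ : a.1 = b.1) (h₂ : a.2 = b.2) : f a = f b := by
  rw [Prod.ext h₁ h₂]

theorem mulMonomial_add_apply (d : ℕ × ℕ) (f : H2) (a : ℕ × ℕ) :
    mulMonomial d f (a + d) = f a := by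
  rw [mulMonomial_apply, if_pos ⟨Nat.le_add_left _ _, Nat.le_add_left _ _⟩]
  exact f.apply_congr (by simp) (by simp)

theorem mulMonomial_mulMonomial (d e : ℕ × ℕ) (f : H2) :
    mulMonomial d (mulMonomial e f) = mulMonomial (d + e) f := by
  ext ⟨b₁, b₂⟩
  obtain ⟨d₁, d₂⟩ := d
  obtain ⟨e₁, e₂⟩ := e
  simp only [mulMonomial_apply, Prod.mk_le_mk, Prod.mk_sub_mk, Prod.mk_add_mk]
  split_ifs <;> first | exact f.apply_congr (by simp; omega) (by simp; omega) | omega | rfl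

/-- The monomial `z₁^{a.1} z₂^{a.2}` as an element of the Hardy space. -/
def monomial (a : ℕ × ℕ) : H2 := lp.single 2 a 1

theorem inner_monomial_left (a : ℕ × ℕ) (f : H2) : inner ℂ (monomial a) f = f a := by
  rw [monomial, lp.inner_single_left]; simp

theorem monomial_apply (a b : ℕ × ℕ) : monomial a b = if b = a then 1 else 0 := by
  rw [monomial, lp.single_apply]
  by_cases h : b = a
  · subst h; simp
  · simp [h]

theorem mulMonomial_monomial (d a : ℕ × ℕ) :
    mulMonomial d (monomial a) = monomial (d + a) := by
  ext ⟨b₁, b₂⟩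
  obtain ⟨d₁, d₂⟩ := d
  obtain ⟨a₁, a₂⟩ := a
  simp only [mulMonomial_apply, monomial_apply, Prod.mk_le_mk, Prod.mk_sub_mk, Prod.mk_add_mk,
    Prod.mk.injEq]
  split_ifs <;> first | omega | rfl

/-- The adjoint of multiplication by a monomial: the backward shift of the coefficients. -/
def backShift (d : ℕ × ℕ) : H2 →L[ℂ] H2 :=
  (mulMonomial d).toContinuousLinearMap.adjoint

theorem inner_backShift_right (d : ℕ × ℕ) (f g : H2) :
    inner ℂ f (backShift d g) = inner ℂ (mulMonomial d f) g :=
  ContinuousLinearMap.adjoint_inner_right _ _ _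

theorem inner_backShift_left (d : ℕ × ℕ) (f g : H2) :
    inner ℂ (backShift d f) g = inner ℂ f (mulMonomial d g) :=
  ContinuousLinearMap.adjoint_inner_left _ _ _

theorem backShift_apply (d : ℕ × ℕ) (f : H2) (a : ℕ × ℕ) : backShift d f a = f (d + a) := by
  rw [← inner_monomial_left, inner_backShift_right, mulMonomial_monomial, inner_monomial_left]

theorem backShift_mulMonomial {x y u v : ℕ × ℕ} (h : x + v = y + u) (f : H2) :
    backShift x (mulMonomial y f) = backShift u (mulMonomial v f) := by
  ext ⟨a₁, a₂⟩
  obtain ⟨x₁, x₂⟩ := x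
  obtain ⟨y₁, y₂⟩ := y
  obtain ⟨u₁, u₂⟩ := u
  obtain ⟨v₁, v₂⟩ := v
  simp only [Prod.mk_add_mk, Prod.mk.injEq] at h
  simp only [backShift_apply, mulMonomial_apply, Prod.mk_le_mk, Prod.mk_sub_mk, Prod.mk_add_mk]
  split_ifs <;> first | exact f.apply_congr (by simp; omega) (by simp; omega) | omega | rfl

theorem backShift_backShift (d e : ℕ × ℕ) (f : H2) :
    backShift d (backShift e f) = backShift (d + e) f := by
  ext a
  rw [backShift_apply, backShift_apply, backShift_apply]
  exact f.apply_congr (by simp; omega) (by simp; omega)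

/-! ### Point evaluations -/

/-- The reproducing kernel of `H²(𝔻²)` at a point of the bidisk. -/
def kernel (w : Fin 2 → ℂ) (hw : w ∈ bidisk) : H2 :=
  ⟨fun a => conj (w 0 ^ a.1 * w 1 ^ a.2), by
    refine memℓp_gen ?_
    have h : ∀ i, ‖w i‖ ^ 2 < 1 := fun i => by
      have := hw i; have := norm_nonneg (w i); nlinarith
    refine ((summable_geometric_of_lt_one (by positivity) (h 0)).mul_of_nonneg
      (summable_geometric_of_lt_one (by positivity) (h 1))
      (fun _ => by positivity) (fun _ => by positivity)).congr fun a => ?_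
    simp [mul_pow, ← pow_mul, mul_comm]⟩

theorem inner_kernel_left {w : Fin 2 → ℂ} (hw : w ∈ bidisk) (f : H2) :
    inner ℂ (kernel w hw) f = f.value w := by
  rw [lp.inner_eq_tsum, H2.value]
  refine tsum_congr fun a => ?_
  simp [kernel]

theorem H2.value_add (f g : H2) {z : Fin 2 → ℂ} (hz : z ∈ bidisk) :
    (f + g).value z = f.value z + g.value z := by
  simp only [← inner_kernel_left hz, inner_add_right]

theorem H2.value_sub (f g : H2) {z : Fin 2 → ℂ} (hz : z ∈ bidisk) :
    (f - g).value z = f.value z - g.value z := by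
  simp only [← inner_kernel_left hz, inner_sub_right]

theorem H2.value_smul (c : ℂ) (f : H2) {z : Fin 2 → ℂ} (hz : z ∈ bidisk) :
    (c • f).value z = c * f.value z := by
  simp only [← inner_kernel_left hz, inner_smul_right]

theorem value_mulMonomial (d : ℕ × ℕ) (f : H2) (z : Fin 2 → ℂ) :
    (mulMonomial d f).value z = z 0 ^ d.1 * z 1 ^ d.2 * f.value z := by
  rw [H2.value, H2.value, ← tsum_mul_left]
  have hinj : Function.Injective fun a : ℕ × ℕ => a + d := add_left_injective d
  refine (hinj.tsum_eq ?_).symm.trans (tsum_congr fun a => ?_)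
  · intro b hb
    by_contra hb'
    refine hb ?_
    change mulMonomial d f b * _ = 0
    rw [mulMonomial_apply, if_neg fun h => hb' ⟨b - d, ?_⟩, zero_mul]
    ext
    · exact Nat.sub_add_cancel h.1
    · exact Nat.sub_add_cancel h.2
  · rw [mulMonomial_add_apply, Prod.fst_add, Prod.snd_add]
    ring

theorem value_monomial (a : ℕ × ℕ) (z : Fin 2 → ℂ) :
    (monomial a).value z = z 0 ^ a.1 * z 1 ^ a.2 := by
  rw [H2.value, tsum_eq_single a]
  · simp [monomial_apply]
  · intro b hb; simp [monomial_apply, hb]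

theorem value_kernel {z w : Fin 2 → ℂ} (hz : z ∈ bidisk) (hw : w ∈ bidisk) :
    (1 - z 0 * conj (w 0)) * (1 - z 1 * conj (w 1)) * (kernel w hw).value z = 1 := by
  have h : ∀ i, ‖z i * conj (w i)‖ < 1 := fun i => by
    rw [norm_mul, RCLike.norm_conj]
    have := hw i; have := hz i; have := norm_nonneg (w i); have := norm_nonneg (z i); nlinarith
  have h1 := tsum_mul_tsum_of_summable_norm (summable_norm_geometric_of_norm_lt_one (h 0))
    (summable_norm_geometric_of_norm_lt_one (h 1))
  have h2 : (kernel w hw).value z =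
      ∑' a : ℕ × ℕ, (z 0 * conj (w 0)) ^ a.1 * (z 1 * conj (w 1)) ^ a.2 := by
    refine tsum_congr fun a => ?_
    simp only [kernel, map_mul, map_pow, mul_pow]
    ring
  have hne : ∀ i, 1 - z i * conj (w i) ≠ 0 := fun i hi => by
    have := h i
    rw [← sub_eq_zero.1 hi] at this
    simp at this
  rw [h2, ← h1, tsum_geometric_of_norm_lt_one (h 0), tsum_geometric_of_norm_lt_one (h 1)]
  field_simp [hne 0, hne 1]

theorem bidisk_of_norm_lt {z : Fin 2 → ℂ} (h0 : ‖z 0‖ < 1) (h1 : ‖z 1‖ < 1) : z ∈ bidisk := by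
  intro i
  fin_cases i <;> assumption

theorem norm_value_le (f : H2) {z : Fin 2 → ℂ} (h0 : ‖z 0‖ ≤ 1 / 2) (h1 : ‖z 1‖ ≤ 1 / 2) :
    ‖f.value z‖ ≤ 4 * ‖f‖ := by
  have hs : Summable fun a : ℕ × ℕ => (1 / 2 : ℝ) ^ a.1 * (1 / 2 : ℝ) ^ a.2 :=
    summable_geometric_two.mul_of_nonneg summable_geometric_two
      (fun _ => by positivity) (fun _ => by positivity)
  have hsum : ∑' a : ℕ × ℕ, (1 / 2 : ℝ) ^ a.1 * (1 / 2 : ℝ) ^ a.2 = 4 := by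
    rw [← summable_geometric_two.tsum_mul_tsum summable_geometric_two hs, tsum_geometric_two]
    norm_num
  refine (tsum_of_norm_bounded (hs.hasSum.mul_left ‖f‖) fun a => ?_).trans_eq
    (by rw [hsum]; ring)
  rw [norm_mul, norm_mul, norm_pow, norm_pow]
  gcongr
  exact lp.norm_apply_le_norm (by norm_num) f a

/-! ### Uniqueness of the power series -/

theorem mul_value_backShift_fst (f : H2) {z : Fin 2 → ℂ} (hz : z ∈ bidisk) :
    z 0 * (backShift (1, 0) f).value z = f.value z - f.value ![0, z 1] := by
  have h1 : z 0 * (backShift (1, 0) f).value z =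
      (mulMonomial (1, 0) (backShift (1, 0) f)).value z := by
    rw [value_mulMonomial]; simp
  have h2 : (f - mulMonomial (1, 0) (backShift (1, 0) f)).value z = f.value ![0, z 1] := by
    refine tsum_congr fun ⟨j, k⟩ => ?_
    rw [lp.coeFn_sub, Pi.sub_apply, mulMonomial_apply]
    rcases j with _ | j
    · simp
    · rw [if_pos ⟨by simp, by simp⟩, backShift_apply,
        f.apply_congr (b := (j + 1, k)) (by simp) (by simp)]
      simp [add_comm 1]
  rw [h1, ← h2, H2.value_sub _ _ hz]
  ring

theorem mul_value_backShift_snd (f : H2) {z : Fin 2 → ℂ} (hz : z ∈ bidisk) :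
    z 1 * (backShift (0, 1) f).value z = f.value z - f.value ![z 0, 0] := by
  have h1 : z 1 * (backShift (0, 1) f).value z =
      (mulMonomial (0, 1) (backShift (0, 1) f)).value z := by
    rw [value_mulMonomial]; simp
  have h2 : (f - mulMonomial (0, 1) (backShift (0, 1) f)).value z = f.value ![z 0, 0] := by
    refine tsum_congr fun ⟨j, k⟩ => ?_
    rw [lp.coeFn_sub, Pi.sub_apply, mulMonomial_apply]
    rcases k with _ | k
    · simp
    · rw [if_pos ⟨by simp, by simp⟩, backShift_apply,
        f.apply_congr (b := (j, k + 1)) (by simp) (by simp)]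
      simp [add_comm 1]
  rw [h1, ← h2, H2.value_sub _ _ hz]
  ring

theorem eq_zero_of_forall_norm_le_mul {c : ℂ} {C : ℝ}
    (h : ∀ x : ℝ, 0 < x → x ≤ 1 / 2 → ‖c‖ ≤ x * C) : c = 0 := by
  have h1 : Tendsto (fun x : ℝ => x * C) (𝓝[>] 0) (𝓝 (0 * C)) :=
    (tendsto_id.mul_const C).mono_left nhdsWithin_le_nhds
  have h2 : ‖c‖ ≤ 0 * C := by
    refine ge_of_tendsto h1 ?_
    filter_upwards [Ioc_mem_nhdsGT (show (0 : ℝ) < 1 / 2 by norm_num)] with x hx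
    exact h x hx.1 hx.2
  simpa using h2

theorem value_backShift_fst_eq_zero {f : H2}
    (hf : ∀ z : Fin 2 → ℂ, ‖z 0‖ ≤ 1 / 2 → ‖z 1‖ ≤ 1 / 2 → f.value z = 0)
    (z : Fin 2 → ℂ) (h0 : ‖z 0‖ ≤ 1 / 2) (h1 : ‖z 1‖ ≤ 1 / 2) :
    (backShift (1, 0) f).value z = 0 := by
  have key : ∀ w : Fin 2 → ℂ, ‖w 0‖ ≤ 1 / 2 → ‖w 1‖ ≤ 1 / 2 → w 0 ≠ 0 →
      (backShift (1, 0) f).value w = 0 := fun w hw0 hw1 hne => by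
    have := mul_value_backShift_fst f (z := w)
      (bidisk_of_norm_lt (by linarith) (by linarith))
    rw [hf w hw0 hw1, hf ![0, w 1] (by simp) hw1, sub_zero] at this
    exact (mul_eq_zero.1 this).resolve_left hne
  by_cases hz : z 0 = 0
  · refine eq_zero_of_forall_norm_le_mul
      (C := 4 * ‖backShift (1, 0) (backShift (1, 0) f)‖) fun x hx hx' => ?_
    have hxn : ‖(![(x : ℂ), z 1] : Fin 2 → ℂ) 0‖ ≤ 1 / 2 := by simpa [abs_of_pos hx] using hx'
    have := mul_value_backShift_fst (backShift (1, 0) f) (z := ![(x : ℂ), z 1])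
      (bidisk_of_norm_lt (by linarith) (by simpa using h1.trans_lt (by norm_num)))
    rw [key ![(x : ℂ), z 1] hxn h1 (by simpa using hx.ne')] at this
    have hz' : (![0, (![(x : ℂ), z 1] : Fin 2 → ℂ) 1] : Fin 2 → ℂ) = z := by
      ext i; fin_cases i <;> simp [hz]
    rw [hz', zero_sub] at this
    rw [← norm_neg, ← this, norm_mul]
    have h2 := norm_value_le (backShift (1, 0) (backShift (1, 0) f)) hxn h1
    simp only [Matrix.cons_val_zero, Complex.norm_real, Real.norm_eq_abs, abs_of_pos hx]
    gcongr
  · exact key z h0 h1 hz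

theorem value_backShift_snd_eq_zero {f : H2}
    (hf : ∀ z : Fin 2 → ℂ, ‖z 0‖ ≤ 1 / 2 → ‖z 1‖ ≤ 1 / 2 → f.value z = 0)
    (z : Fin 2 → ℂ) (h0 : ‖z 0‖ ≤ 1 / 2) (h1 : ‖z 1‖ ≤ 1 / 2) :
    (backShift (0, 1) f).value z = 0 := by
  have key : ∀ w : Fin 2 → ℂ, ‖w 0‖ ≤ 1 / 2 → ‖w 1‖ ≤ 1 / 2 → w 1 ≠ 0 →
      (backShift (0, 1) f).value w = 0 := fun w hw0 hw1 hne => by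
    have := mul_value_backShift_snd f (z := w)
      (bidisk_of_norm_lt (by linarith) (by linarith))
    rw [hf w hw0 hw1, hf ![w 0, 0] hw0 (by simp), sub_zero] at this
    exact (mul_eq_zero.1 this).resolve_left hne
  by_cases hz : z 1 = 0
  · refine eq_zero_of_forall_norm_le_mul
      (C := 4 * ‖backShift (0, 1) (backShift (0, 1) f)‖) fun x hx hx' => ?_
    have hxn : ‖(![z 0, (x : ℂ)] : Fin 2 → ℂ) 1‖ ≤ 1 / 2 := by simpa [abs_of_pos hx] using hx'
    have := mul_value_backShift_snd (backShift (0, 1) f) (z := ![z 0, (x : ℂ)])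
      (bidisk_of_norm_lt (by simpa using h0.trans_lt (by norm_num)) (by linarith))
    rw [key ![z 0, (x : ℂ)] h0 hxn (by simpa using hx.ne')] at this
    have hz' : (![(![z 0, (x : ℂ)] : Fin 2 → ℂ) 0, 0] : Fin 2 → ℂ) = z := by
      ext i; fin_cases i <;> simp [hz]
    rw [hz', zero_sub] at this
    rw [← norm_neg, ← this, norm_mul]
    have h2 := norm_value_le (backShift (0, 1) (backShift (0, 1) f)) (z := ![z 0, (x : ℂ)]) h0 hxn
    simp only [Matrix.cons_val_one, Matrix.cons_val_fin_one, Complex.norm_real, Real.norm_eq_abs,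
      abs_of_pos hx]
    gcongr
  · exact key z h0 h1 hz

theorem eq_zero_of_value_eq_zero {f : H2} (hf : ∀ z ∈ bidisk, f.value z = 0) : f = 0 := by
  have step : ∀ (j k : ℕ) (z : Fin 2 → ℂ), ‖z 0‖ ≤ 1 / 2 → ‖z 1‖ ≤ 1 / 2 →
      (backShift (j, k) f).value z = 0 := by
    intro j
    induction j with
    | zero =>
      intro k
      induction k with
      | zero =>
        intro z h0 h1
        have : backShift (0, 0) f = f := by
          ext a
          rw [backShift_apply]
          exact f.apply_congr (by simp) (by simp)
        rw [this]
        exact hf z (bidisk_of_norm_lt (by linarith) (by linarith))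
      | succ k ih =>
        intro z h0 h1
        have := value_backShift_snd_eq_zero ih z h0 h1
        rwa [backShift_backShift, Prod.mk_add_mk, zero_add, add_comm 1] at this
    | succ j ih =>
      intro k z h0 h1
      have := value_backShift_fst_eq_zero (ih k) z h0 h1
      rwa [backShift_backShift, Prod.mk_add_mk, zero_add, add_comm 1] at this
  ext ⟨j, k⟩
  have h := step j k 0 (by simp) (by simp)
  rw [H2.value, tsum_eq_single (0, 0)] at h
  · simpa [backShift_apply] using h
  · rintro ⟨a, b⟩ hab
    rcases a with _ | a
    · rcases b with _ | b
      · exact absurd rfl hab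
      · simp
    · simp

theorem ext_of_value {f g : H2} (h : ∀ z ∈ bidisk, f.value z = g.value z) : f = g :=
  sub_eq_zero.1 <| eq_zero_of_value_eq_zero fun z hz => by
    rw [H2.value_sub _ _ hz, h z hz, sub_self]

theorem dense_span_kernel :
    Dense (Submodule.span ℂ {k : H2 | ∃ w, ∃ hw : w ∈ bidisk, k = kernel w hw} : Set H2) := by
  rw [Submodule.dense_iff_topologicalClosure_eq_top, Submodule.topologicalClosure_eq_top_iff,
    Submodule.eq_bot_iff]
  intro f hf
  refine eq_zero_of_value_eq_zero fun z hz => ?_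
  rw [← inner_kernel_left hz]
  exact hf _ (Submodule.subset_span ⟨z, hz, rfl⟩)

/-! ### Multiplication by polynomials -/

/-- Multiplication by a polynomial on the Hardy space. -/
def polyOp (P : MvPolynomial (Fin 2) ℂ) : H2 →L[ℂ] H2 :=
  ∑ b ∈ P.support, P.coeff b • (mulMonomial (b 0, b 1)).toContinuousLinearMap

theorem polyOp_apply (P : MvPolynomial (Fin 2) ℂ) (f : H2) :
    polyOp P f = ∑ b ∈ P.support, P.coeff b • mulMonomial (b 0, b 1) f := by
  simp [polyOp]

theorem value_polyOp (P : MvPolynomial (Fin 2) ℂ) (f : H2) {z : Fin 2 → ℂ} (hz : z ∈ bidisk) :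
    (polyOp P f).value z = MvPolynomial.eval z P * f.value z := by
  rw [polyOp_apply, ← inner_kernel_left hz, inner_sum, MvPolynomial.eval_eq', Finset.sum_mul]
  refine Finset.sum_congr rfl fun b _ => ?_
  rw [inner_smul_right, inner_kernel_left, value_mulMonomial, Fin.prod_univ_two]
  ring

theorem polyOp_mul (P Q : MvPolynomial (Fin 2) ℂ) (f : H2) :
    polyOp (P * Q) f = polyOp P (polyOp Q f) :=
  ext_of_value fun z hz => by
    rw [value_polyOp _ _ hz, value_polyOp _ _ hz, value_polyOp _ _ hz, map_mul, mul_assoc]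

theorem polyOp_mulMonomial (P : MvPolynomial (Fin 2) ℂ) (d : ℕ × ℕ) (f : H2) :
    polyOp P (mulMonomial d f) = mulMonomial d (polyOp P f) :=
  ext_of_value fun z hz => by
    rw [value_polyOp _ _ hz, value_mulMonomial, value_mulMonomial, value_polyOp _ _ hz]
    ring

theorem polyOp_injective {P : MvPolynomial (Fin 2) ℂ}
    (hP : ∀ z ∈ bidisk, MvPolynomial.eval z P ≠ 0) : Function.Injective (polyOp P) := by
  intro f g h
  refine ext_of_value fun z hz => mul_left_cancel₀ (hP z hz) ?_
  rw [← value_polyOp _ _ hz, ← value_polyOp _ _ hz, h]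

theorem toContinuousLinearMap_pow_apply (d : ℕ × ℕ) (n : ℕ) (f : H2) :
    ((mulMonomial d).toContinuousLinearMap ^ n : H2 →L[ℂ] H2) f =
      mulMonomial (n * d.1, n * d.2) f := by
  induction n with
  | zero => exact ext_of_value fun z _ => by rw [value_mulMonomial]; simp
  | succ n ih =>
    rw [pow_succ', ContinuousLinearMap.mul_def, ContinuousLinearMap.comp_apply, ih]
    refine ext_of_value fun z _ => ?_
    change (mulMonomial d _).value z = _
    rw [value_mulMonomial, value_mulMonomial, value_mulMonomial]
    ring

theorem mulMonomial_pow (j k : ℕ) (f : H2) :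
    (((mulMonomial (1, 0)).toContinuousLinearMap ^ j *
      (mulMonomial (0, 1)).toContinuousLinearMap ^ k : H2 →L[ℂ] H2)) f = mulMonomial (j, k) f := by
  rw [ContinuousLinearMap.mul_def, ContinuousLinearMap.comp_apply, toContinuousLinearMap_pow_apply,
    toContinuousLinearMap_pow_apply, mulMonomial_mulMonomial]
  simp

theorem isUnit_of_eval_ne_zero {B : Type*} [NormedRing B] [NormOneClass B] [NormedAlgebra ℂ B]
    [CompleteSpace B] {x y : B} (hxy : x * y = y * x) (hx : ‖x‖ ≤ 1) (hy : ‖y‖ ≤ 1)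
    {P : MvPolynomial (Fin 2) ℂ}
    (hP : ∀ z : Fin 2 → ℂ, (∀ i, ‖z i‖ ≤ 1) → MvPolynomial.eval z P ≠ 0) :
    IsUnit (∑ b ∈ P.support, P.coeff b • (x ^ b 0 * y ^ b 1)) := by
  let s := Algebra.adjoin ℂ ({x, y} : Set B)
  have hs : ∀ u v : s, u * v = v * u := by
    have hc := Algebra.isMulCommutative_adjoin ℂ (s := ({x, y} : Set B)) (by
      rintro a (rfl | rfl) b (rfl | rfl) <;> simp [hxy])
    exact fun u v => mul_comm' u v
  let A := s.topologicalClosure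
  have hxs : x ∈ A := s.le_topologicalClosure (Algebra.subset_adjoin (by simp))
  have hys : y ∈ A := s.le_topologicalClosure (Algebra.subset_adjoin (by simp))
  let _ : NormedCommRing A :=
    { (inferInstance : NormedRing A) with
      mul_comm := (s.commRingTopologicalClosure hs).mul_comm }
  have : CompleteSpace A := s.isClosed_topologicalClosure.completeSpace_coe
  have : NormOneClass A := ⟨norm_one (α := B)⟩
  let a : A := ∑ b ∈ P.support, P.coeff b • ((⟨x, hxs⟩ : A) ^ b 0 * (⟨y, hys⟩ : A) ^ b 1)
  have ha : IsUnit a := by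
    by_contra hna
    obtain ⟨φ, hφ⟩ := WeakDual.CharacterSpace.exists_apply_eq_zero hna
    refine hP ![φ ⟨x, hxs⟩, φ ⟨y, hys⟩] ?_ ?_
    · have h (u : A) (hu : ‖(u : B)‖ ≤ 1) : ‖φ u‖ ≤ 1 :=
        (AlgHom.norm_apply_le_self φ u).trans hu
      intro i
      fin_cases i
      · exact h _ hx
      · exact h _ hy
    · rw [← hφ, MvPolynomial.eval_eq', map_sum]
      refine Finset.sum_congr rfl fun b _ => ?_
      rw [map_smul, map_mul, map_pow, map_pow, Fin.prod_univ_two]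
      rfl
  have := ha.map A.val
  simpa [a] using this

instance : Nontrivial H2 :=
  ⟨monomial 0, 0, fun h => by
    have := congrArg (fun f : H2 => (f 0 : ℂ)) h
    simp [monomial_apply] at this⟩

/-- A polynomial without zeros on the closed bidisk is invertible as a multiplier of the Hardy
space. -/
theorem isUnit_polyOp {P : MvPolynomial (Fin 2) ℂ}
    (hP : ∀ z : Fin 2 → ℂ, (∀ i, ‖z i‖ ≤ 1) → MvPolynomial.eval z P ≠ 0) :
    IsUnit (polyOp P) := by
  have h := isUnit_of_eval_ne_zero (B := H2 →L[ℂ] H2)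
    (x := (mulMonomial (1, 0)).toContinuousLinearMap)
    (y := (mulMonomial (0, 1)).toContinuousLinearMap)
    (ContinuousLinearMap.ext fun f => by
      change mulMonomial _ (mulMonomial _ f) = mulMonomial _ (mulMonomial _ f)
      rw [mulMonomial_mulMonomial, mulMonomial_mulMonomial, add_comm])
    (mulMonomial (1, 0)).norm_toContinuousLinearMap_le
    (mulMonomial (0, 1)).norm_toContinuousLinearMap_le hP
  convert h using 1
  refine Finset.sum_congr rfl fun b _ => ?_
  congr 1
  exact ContinuousLinearMap.ext fun f => (mulMonomial_pow _ _ f).symm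

theorem exists_norm_le_mul_norm_polyOp {P : MvPolynomial (Fin 2) ℂ}
    (hP : ∀ z : Fin 2 → ℂ, (∀ i, ‖z i‖ ≤ 1) → MvPolynomial.eval z P ≠ 0) :
    ∃ C : ℝ, 0 < C ∧ ∀ f, ‖f‖ ≤ C * ‖polyOp P f‖ := by
  obtain ⟨u, hu⟩ := isUnit_polyOp hP
  refine ⟨‖(↑u⁻¹ : H2 →L[ℂ] H2)‖ + 1, by positivity, fun f => ?_⟩
  have h : (↑u⁻¹ : H2 →L[ℂ] H2) (polyOp P f) = f := by
    rw [← hu]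
    exact congrArg (fun T : H2 →L[ℂ] H2 => T f) u.inv_mul
  calc ‖f‖ = ‖(↑u⁻¹ : H2 →L[ℂ] H2) (polyOp P f)‖ := by rw [h]
    _ ≤ ‖(↑u⁻¹ : H2 →L[ℂ] H2)‖ * ‖polyOp P f‖ := ContinuousLinearMap.le_opNorm _ _
    _ ≤ _ := by gcongr; linarith

/-! ### Zeros of polynomials -/

theorem norm_prod_sub_le (s : Multiset ℂ) {c x : ℂ} {ε : ℝ} (hε : 0 < ε)
    (hs : ∀ a ∈ s, ε ≤ ‖a - c‖) :
    ‖(s.map (x - ·)).prod‖ ≤ ‖(s.map (c - ·)).prod‖ * (1 + ‖x - c‖ / ε) ^ s.card := by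
  induction s using Multiset.induction_on with
  | empty => simp
  | cons a s ih =>
    have h1 := ih fun b hb => hs b (Multiset.mem_cons_of_mem hb)
    have h2 : ‖x - a‖ ≤ ‖c - a‖ * (1 + ‖x - c‖ / ε) := by
      have h3 : ε ≤ ‖c - a‖ := by
        rw [norm_sub_rev]; exact hs a (Multiset.mem_cons_self a s)
      have h4 : ‖x - a‖ ≤ ‖x - c‖ + ‖c - a‖ := by
        simpa using norm_add_le (x - c) (c - a)
      have h5 : ‖x - c‖ ≤ ‖c - a‖ * (‖x - c‖ / ε) := by
        rw [mul_div_assoc', le_div_iff₀ hε, mul_comm]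
        gcongr
      linarith
    simp only [Multiset.map_cons, Multiset.prod_cons, norm_mul, Multiset.card_cons, pow_succ]
    calc _ ≤ (‖c - a‖ * (1 + ‖x - c‖ / ε)) *
        (‖(s.map (c - ·)).prod‖ * (1 + ‖x - c‖ / ε) ^ s.card) := by gcongr
      _ = _ := by ring

theorem norm_eval_le_of_forall_ne_zero {P : Polynomial ℂ} {c : ℂ} {ε : ℝ} (hε : 0 < ε)
    (hP : ∀ y, ‖y - c‖ < ε → P.eval y ≠ 0) {d : ℕ} (hd : P.natDegree ≤ d) (x : ℂ) :
    ‖P.eval x‖ ≤ ‖P.eval c‖ * (1 + ‖x - c‖ / ε) ^ d := by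
  have hs := IsAlgClosed.splits P
  have h := norm_prod_sub_le P.roots (x := x) (c := c) hε fun a ha => by
    by_contra hlt
    exact hP a (not_le.1 hlt) (Polynomial.isRoot_of_mem_roots ha)
  have h1 : (1 : ℝ) ≤ 1 + ‖x - c‖ / ε := by
    have : 0 ≤ ‖x - c‖ / ε := by positivity
    linarith
  rw [hs.eval_eq_prod_roots, hs.eval_eq_prod_roots, norm_mul, norm_mul, mul_assoc]
  refine mul_le_mul_of_nonneg_left (h.trans ?_) (norm_nonneg _)
  gcongr
  exact (Polynomial.card_roots' P).trans hd

theorem eval_aeval (g : Fin 2 → Polynomial ℂ) (p : MvPolynomial (Fin 2) ℂ) (x : ℂ) :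
    (MvPolynomial.aeval g p).eval x = MvPolynomial.eval (fun k => (g k).eval x) p := by
  have h : ((Polynomial.aeval x).comp (MvPolynomial.aeval g) : MvPolynomial (Fin 2) ℂ →ₐ[ℂ] ℂ) =
      MvPolynomial.aeval fun k => (g k).eval x := by
    ext k
    simp
  simpa [MvPolynomial.aeval_eq_eval] using congrArg (fun φ => φ p) h

theorem norm_eval_curve_le {p : MvPolynomial (Fin 2) ℂ} (g : Fin 2 → Polynomial ℂ)
    (hg : ∀ k, (g k).natDegree ≤ 1) {c : ℂ} {ε : ℝ} (hε : 0 < ε)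
    (hp : ∀ y, ‖y - c‖ < ε → MvPolynomial.eval (fun k => (g k).eval y) p ≠ 0) (x : ℂ) :
    ‖MvPolynomial.eval (fun k => (g k).eval x) p‖ ≤
      ‖MvPolynomial.eval (fun k => (g k).eval c) p‖ * (1 + ‖x - c‖ / ε) ^ p.totalDegree := by
  simp only [← eval_aeval] at hp ⊢
  exact norm_eval_le_of_forall_ne_zero hε hp
    ((MvPolynomial.aeval_natDegree_le p le_rfl g hg).trans_eq (mul_one _)) x

theorem continuous_eval_mvPolynomial (p : MvPolynomial (Fin 2) ℂ) :
    Continuous fun z : Fin 2 → ℂ => MvPolynomial.eval z p :=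
  MvPolynomial.continuous_eval p

/-- A form of Hurwitz's theorem: if a polynomial vanishes at `c`, but has no zeros close to `c` on
the lines parallel to the `i`-th axis through `s c` for `s` close to `1` from below, then it
vanishes on the line through `c`. -/
theorem eval_update_eq_zero {p : MvPolynomial (Fin 2) ℂ} {c : Fin 2 → ℂ}
    (hc : MvPolynomial.eval c p = 0) (i : Fin 2) {ε : ℝ} (hε : 0 < ε)
    (h : ∀ᶠ s : ℝ in 𝓝[<] 1, ∀ y, ‖y - c i‖ < ε →
      MvPolynomial.eval (Function.update (fun k => (s : ℂ) * c k) i y) p ≠ 0) (x : ℂ) :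
    MvPolynomial.eval (Function.update c i x) p = 0 := by
  have hcont (y : ℂ) : Tendsto (fun s : ℝ =>
      MvPolynomial.eval (Function.update (fun k => (s : ℂ) * c k) i y) p) (𝓝[<] 1)
      (𝓝 (MvPolynomial.eval (Function.update c i y) p)) := by
    have h1 : Continuous fun s : ℝ =>
        MvPolynomial.eval (Function.update (fun k => (s : ℂ) * c k) i y) p :=
      (continuous_eval_mvPolynomial p).comp
        ((continuous_pi fun k => by fun_prop).update i continuous_const)
    have h2 := h1.tendsto 1
    simp only [Complex.ofReal_one, one_mul] at h2
    exact h2.mono_left nhdsWithin_le_nhds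
  have h0 := ((hcont (c i)).norm.mul_const ((1 + ‖x - c i‖ / ε) ^ p.totalDegree))
  rw [Function.update_eq_self, hc, norm_zero, zero_mul] at h0
  refine norm_le_zero_iff.1 (le_of_tendsto_of_tendsto (hcont x).norm h0 ?_)
  filter_upwards [h] with s hs
  have key (y : ℂ) : (fun k => (Function.update (fun k => Polynomial.C ((s : ℂ) * c k)) i
      Polynomial.X k).eval y) = Function.update (fun k => (s : ℂ) * c k) i y := by
    ext k
    by_cases hk : k = i
    · subst hk; simp
    · simp [hk]
  have := norm_eval_curve_le (p := p) (Function.update (fun k => Polynomial.C ((s : ℂ) * c k)) i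
      Polynomial.X) (fun k => ?_) hε (c := c i) (fun y hy => ?_) x
  · simpa only [key] using this
  · by_cases hk : k = i
    · subst hk; simp
    · rw [Function.update_of_ne hk, Polynomial.natDegree_C]
      exact zero_le_one
  · simpa only [key] using hs y hy

/-! ### Elimination for coprime polynomials -/

theorem isCoprime_map_of_isRelPrime {R K : Type*} [CommRing R] [IsDomain R]
    [UniqueFactorizationMonoid R] [Field K] [Algebra R K] [IsFractionRing R K]
    {P Q : Polynomial R} (hP : P ≠ 0) (h : IsRelPrime P Q) :
    IsCoprime (P.map (algebraMap R K)) (Q.map (algebraMap R K)) := by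
  classical
  have : NormalizedGCDMonoid R := Nonempty.some inferInstance
  rw [← isRelPrime_iff_isCoprime]
  intro d hdP hdQ
  have hd0 : d ≠ 0 := by
    rintro rfl
    rw [zero_dvd_iff, Polynomial.map_eq_zero_iff (IsFractionRing.injective R K)] at hdP
    exact hP hdP
  let π := (IsLocalization.integerNormalization (nonZeroDivisors R) d).primPart
  have hπd : π.map (algebraMap R K) ∣ d := by
    obtain ⟨b, hb, hbd⟩ := IsLocalization.integerNormalization_spec (nonZeroDivisors R) d
    have h1 : π.map (algebraMap R K) ∣
        (IsLocalization.integerNormalization (nonZeroDivisors R) d).map (algebraMap R K) :=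
      Polynomial.map_dvd _ (Polynomial.primPart_dvd _)
    rw [hbd, Algebra.smul_def, Polynomial.algebraMap_apply] at h1
    refine (IsUnit.dvd_mul_left ?_).1 h1
    exact Polynomial.isUnit_C.2 (IsUnit.mk0 _ (IsFractionRing.to_map_ne_zero_of_mem_nonZeroDivisors hb))
  have hprim : π.IsPrimitive := Polynomial.isPrimitive_primPart _
  exact Polynomial.isUnit_or_eq_zero_of_isUnit_integerNormalization_primPart hd0
    (h (hprim.dvd_of_fraction_map_dvd_fraction_map (hπd.trans hdP))
      (hprim.dvd_of_fraction_map_dvd_fraction_map (hπd.trans hdQ)))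

theorem exists_mul_add_mul_eq_C {R : Type*} [CommRing R] [IsDomain R]
    [UniqueFactorizationMonoid R] {P Q : Polynomial R} (hP : P ≠ 0) (h : IsRelPrime P Q) :
    ∃ u v : Polynomial R, ∃ r : R, r ≠ 0 ∧ u * P + v * Q = Polynomial.C r := by
  let K := FractionRing R
  obtain ⟨a, b, hab⟩ := isCoprime_map_of_isRelPrime (K := K) hP h
  obtain ⟨c, c0, hc⟩ := IsLocalization.integerNormalization_spec (nonZeroDivisors R) a
  obtain ⟨d, d0, hd⟩ := IsLocalization.integerNormalization_spec (nonZeroDivisors R) b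
  refine ⟨Polynomial.C d * IsLocalization.integerNormalization (nonZeroDivisors R) a,
    Polynomial.C c * IsLocalization.integerNormalization (nonZeroDivisors R) b, c * d,
    mul_ne_zero (nonZeroDivisors.ne_zero c0) (nonZeroDivisors.ne_zero d0), ?_⟩
  apply Polynomial.map_injective (algebraMap R K) (IsFractionRing.injective R K)
  simp only [Polynomial.map_add, Polynomial.map_mul, Polynomial.map_C, hc, hd, map_mul]
  rw [Algebra.smul_def, Algebra.smul_def, Polynomial.algebraMap_apply, Polynomial.algebraMap_apply]
  linear_combination (Polynomial.C (algebraMap R K c) * Polynomial.C (algebraMap R K d)) * hab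

/-- The second coordinates of the common zeros of two coprime polynomials in two variables are
zeros of a nonzero polynomial in one variable. -/
theorem exists_eliminant {p q : MvPolynomial (Fin 2) ℂ} (hp : p ≠ 0) (h : IsRelPrime p q) :
    ∃ R : Polynomial ℂ, R ≠ 0 ∧ ∀ z : Fin 2 → ℂ, MvPolynomial.eval z p = 0 →
      MvPolynomial.eval z q = 0 → R.eval (z 1) = 0 := by
  let e := MvPolynomial.finSuccEquiv ℂ 1
  have hrel : IsRelPrime (e p) (e q) := fun d h1 h2 => by
    have h1' := map_dvd e.symm h1
    have h2' := map_dvd e.symm h2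
    rw [e.symm_apply_apply] at h1' h2'
    simpa using (h h1' h2').map e
  obtain ⟨u, v, r, hr, huv⟩ := exists_mul_add_mul_eq_C (by simpa using hp) hrel
  have hev (s : Fin 1 → ℂ) : (MvPolynomial.aeval (fun _ : Fin 1 => (Polynomial.X : Polynomial ℂ))
      r).eval (s 0) = MvPolynomial.eval s r := by
    have h : ((Polynomial.aeval (s 0)).comp (MvPolynomial.aeval fun _ : Fin 1 => Polynomial.X) :
        MvPolynomial (Fin 1) ℂ →ₐ[ℂ] ℂ) = MvPolynomial.aeval s := by
      ext k
      fin_cases k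
      simp
    simpa [MvPolynomial.aeval_eq_eval] using congrArg (fun φ => φ r) h
  refine ⟨MvPolynomial.aeval (fun _ => Polynomial.X) r, fun h0 => hr ?_, fun z hzp hzq => ?_⟩
  · refine MvPolynomial.funext fun s => ?_
    rw [← hev, h0]; simp
  · have hz : z = Fin.cons (z 0) (fun _ => z 1) := by
      ext i; fin_cases i <;> rfl
    rw [hz, MvPolynomial.eval_eq_eval_mv_eval'] at hzp hzq
    have := congrArg (fun F => Polynomial.eval (z 0)
      (Polynomial.map (MvPolynomial.eval fun _ : Fin 1 => z 1) F)) huv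
    simp only [Polynomial.map_add, Polynomial.map_mul, Polynomial.eval_add, Polynomial.eval_mul,
      Polynomial.map_C, Polynomial.eval_C] at this
    erw [hzp, hzq] at this
    rw [← hev] at this
    simpa using this.symm

theorem X_sub_C_dvd_of_eval_eq_zero {p : MvPolynomial (Fin 2) ℂ} {t : ℂ}
    (h : ∀ x, MvPolynomial.eval ![x, t] p = 0) :
    MvPolynomial.X 1 - MvPolynomial.C t ∣ p := by
  let I := Ideal.span {(MvPolynomial.X 1 - MvPolynomial.C t : MvPolynomial (Fin 2) ℂ)}
  have h1 : ((Ideal.Quotient.mkₐ ℂ I).comp (MvPolynomial.aeval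
      ![MvPolynomial.X 0, MvPolynomial.C t])) = Ideal.Quotient.mkₐ ℂ I := by
    ext k
    fin_cases k
    · simp
    · simp only [Fin.mk_one, AlgHom.comp_apply, MvPolynomial.aeval_X]
      refine (Ideal.Quotient.eq.2 ?_).symm
      exact Ideal.subset_span rfl
  have h2 : MvPolynomial.aeval ![MvPolynomial.X 0, MvPolynomial.C t] p =
      (0 : MvPolynomial (Fin 2) ℂ) := by
    refine MvPolynomial.funext fun z => ?_
    rw [map_zero, ← h (z 0)]
    have h : ((MvPolynomial.aeval z).comp (MvPolynomial.aeval
        ![MvPolynomial.X 0, MvPolynomial.C t]) : MvPolynomial (Fin 2) ℂ →ₐ[ℂ] ℂ) =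
        MvPolynomial.aeval ![z 0, t] := by
      ext k
      fin_cases k <;> simp
    simpa [MvPolynomial.aeval_eq_eval] using congrArg (fun φ => φ p) h
  have h3 := congrArg (fun φ => φ p) h1
  simp only [AlgHom.comp_apply, h2, map_zero] at h3
  exact Ideal.mem_span_singleton.1 (Ideal.Quotient.eq_zero_iff_mem.1 h3.symm)

theorem exists_eval_ne_zero_of_isRelPrime {p q : MvPolynomial (Fin 2) ℂ} (h : IsRelPrime p q) (t : ℂ) :
    (∃ x, MvPolynomial.eval ![x, t] p ≠ 0) ∨ ∃ x, MvPolynomial.eval ![x, t] q ≠ 0 := by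
  by_contra! hcon
  have hu := (h (X_sub_C_dvd_of_eval_eq_zero hcon.1) (X_sub_C_dvd_of_eval_eq_zero hcon.2)).map
    (MvPolynomial.eval ![0, t])
  simp at hu

/-! ### Rational inner functions and reflected polynomials -/

theorem infinite_unit_circle : {z : ℂ | ‖z‖ = 1}.Infinite := by
  intro h
  have h1 := h.countable
  have h2 : (Metric.sphere (0 : ℂ) 1).Nontrivial :=
    ⟨1, by simp, -1, by simp, by norm_num⟩
  have h3 := (isPreconnected_sphere (E := ℂ) (by simp) 0 1).infinite_of_nontrivial h2
  exact h3 (by simpa [Metric.sphere] using h)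

theorem mvPolynomial_ext_of_torus {p q : MvPolynomial (Fin 2) ℂ}
    (h : ∀ z ∈ torus, MvPolynomial.eval z p = MvPolynomial.eval z q) : p = q :=
  MvPolynomial.funext_set (fun _ => {z : ℂ | ‖z‖ = 1}) (fun _ => infinite_unit_circle)
    fun z hz => h z fun i => hz i (Set.mem_univ i)

theorem exists_eq_exp_of_mem_torus {z : Fin 2 → ℂ} (hz : z ∈ torus) :
    ∃ t : Fin 2 → ℝ, ∀ i, z i = Complex.exp (Complex.I * (t i : ℂ)) := by
  refine ⟨fun i => (z i).arg, fun i => ?_⟩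
  have := Complex.norm_mul_exp_arg_mul_I (z i)
  rw [hz i] at this
  simpa [mul_comm] using this.symm

theorem norm_eval_eq_of_isInner {Θ : (Fin 2 → ℂ) → ℂ} (hΘ : IsInner Θ)
    {p q : MvPolynomial (Fin 2) ℂ} (hpq : ∀ z ∈ bidisk, MvPolynomial.eval z p ≠ 0 ∧
      Θ z = MvPolynomial.eval z q / MvPolynomial.eval z p) {z : Fin 2 → ℂ} (hz : z ∈ torus) :
    ‖MvPolynomial.eval z q‖ = ‖MvPolynomial.eval z p‖ := by
  let φ : (Fin 2 → ℝ) → Fin 2 → ℂ := fun t i => Complex.exp (Complex.I * (t i : ℂ))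
  have hφ : Continuous φ := continuous_pi fun i => by fun_prop
  have hc (P : MvPolynomial (Fin 2) ℂ) : Continuous fun t => ‖MvPolynomial.eval (φ t) P‖ :=
    ((continuous_eval_mvPolynomial P).comp hφ).norm
  have hae : (fun t => ‖MvPolynomial.eval (φ t) q‖) =ᵐ[volume]
      fun t => ‖MvPolynomial.eval (φ t) p‖ := by
    filter_upwards [hΘ.boundary] with t ht
    obtain ⟨b, hb, hlim⟩ := ht
    have hP (P : MvPolynomial (Fin 2) ℂ) : Tendsto
        (fun r : ℝ => MvPolynomial.eval (fun i => (r : ℂ) * φ t i) P) (𝓝[<] 1)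
        (𝓝 (MvPolynomial.eval (φ t) P)) := by
      have h1 : Continuous fun r : ℝ => MvPolynomial.eval (fun i => (r : ℂ) * φ t i) P :=
        (continuous_eval_mvPolynomial P).comp (continuous_pi fun i => by fun_prop)
      have h2 := h1.tendsto 1
      simp only [Complex.ofReal_one, one_mul] at h2
      exact h2.mono_left nhdsWithin_le_nhds
    have h2 := hlim.mul (hP p)
    have h3 : MvPolynomial.eval (φ t) q = b * MvPolynomial.eval (φ t) p := by
      refine tendsto_nhds_unique ((hP q).congr' ?_) h2
      filter_upwards [Ioo_mem_nhdsLT (show (-1 : ℝ) < 1 by norm_num)] with r hr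
      have hrz : (fun i => (r : ℂ) * φ t i) ∈ bidisk := fun i => by
        have : ‖φ t i‖ = 1 := by simp only [φ]; rw [mul_comm, Complex.norm_exp_ofReal_mul_I]
        rw [norm_mul, this, mul_one, Complex.norm_real, Real.norm_eq_abs]
        exact abs_lt.2 hr
      have := hpq _ hrz
      change _ = Θ (fun i => (r : ℂ) * φ t i) * _
      rw [this.2, div_mul_cancel₀ _ this.1]
    rw [h3, norm_mul, hb, one_mul]
  obtain ⟨t, ht⟩ := exists_eq_exp_of_mem_torus hz
  obtain rfl : z = φ t := funext ht
  exact congrFun ((hc q).ae_eq_iff_eq volume (hc p) |>.1 hae) t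

/-- The polynomial `z^N * conj (p (1 / conj z))`, provided that the degree of `p` is at most `N`. -/
def reflect (N : Fin 2 →₀ ℕ) (p : MvPolynomial (Fin 2) ℂ) : MvPolynomial (Fin 2) ℂ :=
  ∑ b ∈ p.support, MvPolynomial.monomial (N - b) (conj (p.coeff b))

theorem eval_reflect (N : Fin 2 →₀ ℕ) (p : MvPolynomial (Fin 2) ℂ) (z : Fin 2 → ℂ) :
    MvPolynomial.eval z (reflect N p) =
      ∑ b ∈ p.support, conj (p.coeff b) * (z 0 ^ (N 0 - b 0) * z 1 ^ (N 1 - b 1)) := by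
  rw [reflect, map_sum]
  refine Finset.sum_congr rfl fun b _ => ?_
  rw [MvPolynomial.eval_monomial, Finsupp.prod_fintype _ _ (by simp), Fin.prod_univ_two]
  rfl

theorem degreeOf_reflect_le (N : Fin 2 →₀ ℕ) (p : MvPolynomial (Fin 2) ℂ) (i : Fin 2) :
    (reflect N p).degreeOf i ≤ N i := by
  refine (MvPolynomial.degreeOf_sum_le _ _ _).trans (Finset.sup_le fun b hb => ?_)
  rw [MvPolynomial.degreeOf_monomial_eq _ _ (by simpa using MvPolynomial.mem_support_iff.1 hb)]
  simp

theorem eval_reflect_of_mem_torus {N : Fin 2 →₀ ℕ} {p : MvPolynomial (Fin 2) ℂ}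
    (hN : ∀ i, p.degreeOf i ≤ N i) {z : Fin 2 → ℂ} (hz : z ∈ torus) :
    MvPolynomial.eval z (reflect N p) =
      z 0 ^ N 0 * z 1 ^ N 1 * conj (MvPolynomial.eval z p) := by
  have hpow (i : Fin 2) {a b : ℕ} (hab : b ≤ a) : z i ^ (a - b) = z i ^ a * conj (z i) ^ b := by
    have h1 : z i * conj (z i) = 1 := by
      rw [Complex.mul_conj, Complex.normSq_eq_norm_sq, hz i]; simp
    obtain ⟨k, rfl⟩ := Nat.exists_eq_add_of_le hab
    rw [Nat.add_sub_cancel_left, pow_add, mul_assoc, mul_comm, mul_assoc, ← mul_pow, mul_comm _ (z i), h1]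
    simp
  rw [eval_reflect, MvPolynomial.eval_eq', map_sum, Finset.mul_sum]
  refine Finset.sum_congr rfl fun b hb => ?_
  have hbN (i : Fin 2) : b i ≤ N i := (MvPolynomial.degreeOf_le_iff.1 (hN i)) b hb
  rw [hpow 0 (hbN 0), hpow 1 (hbN 1), Fin.prod_univ_two, map_mul, map_mul, map_pow, map_pow]
  ring

/-- The numerator of a rational inner function in lowest terms is, up to a unimodular constant, the
reflection of the denominator. -/
theorem exists_eval_eq_mul_eval_reflect {p q : MvPolynomial (Fin 2) ℂ} (hp : p ≠ 0)
    (hrel : IsRelPrime p q)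
    (hT : ∀ z ∈ torus, ‖MvPolynomial.eval z q‖ = ‖MvPolynomial.eval z p‖) {N : Fin 2 →₀ ℕ}
    (hN : ∀ i, max (p.degreeOf i) (q.degreeOf i) = N i) :
    ∃ c : ℂ, ‖c‖ = 1 ∧ ∀ z, MvPolynomial.eval z q = c * MvPolynomial.eval z (reflect N p) := by
  have hNp (i) : p.degreeOf i ≤ N i := (le_max_left _ _).trans_eq (hN i)
  have hNq (i) : q.degreeOf i ≤ N i := (le_max_right _ _).trans_eq (hN i)
  have hq : q ≠ 0 := by
    rintro rfl
    refine hp (mvPolynomial_ext_of_torus fun z hz => ?_)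
    simpa using (hT z hz).symm
  have hmul : q * reflect N q = p * reflect N p := mvPolynomial_ext_of_torus fun z hz => by
    have h := hT z hz
    rw [map_mul, map_mul, eval_reflect_of_mem_torus hNq hz, eval_reflect_of_mem_torus hNp hz]
    have h1 : MvPolynomial.eval z q * conj (MvPolynomial.eval z q) =
        MvPolynomial.eval z p * conj (MvPolynomial.eval z p) := by
      rw [Complex.mul_conj, Complex.mul_conj, Complex.normSq_eq_norm_sq,
        Complex.normSq_eq_norm_sq, h]
    linear_combination (z 0 ^ N 0 * z 1 ^ N 1) * h1
  obtain ⟨s, hs⟩ := hrel.dvd_of_dvd_mul_left ⟨_, hmul⟩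
  have hs' : reflect N p = q * s := by
    refine mul_left_cancel₀ hp ?_
    rw [← hmul, hs]; ring
  have hne : reflect N p ≠ 0 := fun h0 => by
    refine hp (mvPolynomial_ext_of_torus fun z hz => ?_)
    have := eval_reflect_of_mem_torus hNp hz
    rw [h0, map_zero] at this
    have h1 (i) : z i ≠ 0 := norm_ne_zero_iff.1 (by rw [hz i]; exact one_ne_zero)
    simpa [h1] using this.symm
  have hs0 : s ≠ 0 := by
    rintro rfl
    exact hne (by rw [hs', mul_zero])
  have hdeg (i) : s.degreeOf i = 0 := by
    have h1 := degreeOf_reflect_le N p i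
    have h2 := degreeOf_reflect_le N q i
    rw [hs', MvPolynomial.degreeOf_mul_eq hq hs0] at h1
    rw [hs, MvPolynomial.degreeOf_mul_eq hp hs0] at h2
    have := hN i
    omega
  obtain ⟨c, rfl⟩ : ∃ c, s = MvPolynomial.C c := by
    refine ⟨s.coeff 0, MvPolynomial.ext _ _ fun b => ?_⟩
    rw [MvPolynomial.coeff_C]
    split_ifs with hb
    · rw [hb]
    · by_contra hcon
      refine hb (Finsupp.ext fun i => ?_)
      have := MvPolynomial.degreeOf_le_iff.1 (hdeg i).le b (MvPolynomial.mem_support_iff.2 hcon)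
      simp only [Finsupp.coe_zero, Pi.zero_apply]
      omega
  have hc0 : c ≠ 0 := by rintro rfl; simp at hs0
  have hev (z : Fin 2 → ℂ) : MvPolynomial.eval z (reflect N p) = MvPolynomial.eval z q * c := by
    rw [hs', map_mul, MvPolynomial.eval_C]
  refine ⟨c⁻¹, ?_, fun z => by rw [hev]; field_simp⟩
  obtain ⟨z, hz, hpz⟩ : ∃ z ∈ torus, MvPolynomial.eval z p ≠ 0 := by
    by_contra! hcon
    exact hp (mvPolynomial_ext_of_torus fun z hz => by simpa using hcon z hz)
  have h1 := congrArg norm (hev z)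
  rw [eval_reflect_of_mem_torus hNp hz, norm_mul, norm_mul, norm_mul, norm_pow, norm_pow, hz 0,
    hz 1, RCLike.norm_conj, hT z hz] at h1
  have h2 : ‖MvPolynomial.eval z p‖ ≠ 0 := norm_ne_zero_iff.2 hpz
  have h3 : ‖c‖ = 1 := by
    refine mul_left_cancel₀ h2 ?_
    rw [← h1]; ring
  rw [norm_inv, h3, inv_one]

/-- Near a zero of `p` on the torus there are zeros of `p` that are not zeros of `q` and whose
second coordinate lies in the disk. -/
theorem exists_zero_near {p q : MvPolynomial (Fin 2) ℂ} (hp : p ≠ 0) (hrel : IsRelPrime p q)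
    (hT : ∀ z ∈ torus, ‖MvPolynomial.eval z q‖ = ‖MvPolynomial.eval z p‖) {τ : Fin 2 → ℂ}
    (hτ : τ ∈ torus) (hpτ : MvPolynomial.eval τ p = 0) {ε : ℝ} (hε : 0 < ε) :
    ∃ z : Fin 2 → ℂ, ‖z 0 - τ 0‖ < ε ∧ ‖z 1 - τ 1‖ < ε ∧ ‖z 1‖ < 1 ∧
      MvPolynomial.eval z p = 0 ∧ MvPolynomial.eval z q ≠ 0 := by
  by_contra! hcon
  obtain ⟨R, hR, hRz⟩ := exists_eliminant hp hrel
  have hτ1 : τ 1 ≠ 0 := norm_ne_zero_iff.1 (by rw [hτ 1]; exact one_ne_zero)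
  have hfin : {s : ℝ | R.eval ((s : ℂ) * τ 1) = 0}.Finite := by
    refine ((R.roots.toFinset.finite_toSet).preimage (f := fun s : ℝ => (s : ℂ) * τ 1)
      ?_).subset fun s hs => ?_
    · intro a _ b _ hab
      simpa [hτ1] using hab
    · simpa [hR] using hs
  have hne : ∀ᶠ s : ℝ in 𝓝[<] 1, R.eval ((s : ℂ) * τ 1) ≠ 0 := by
    have h1 : ∀ᶠ s : ℝ in 𝓝[≠] 1, R.eval ((s : ℂ) * τ 1) ≠ 0 := by
      have := (hfin.subset Set.sdiff_subset : ({s : ℝ | R.eval ((s : ℂ) * τ 1) = 0} \ {1}).Finite)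
      have h2 := this.isClosed.isOpen_compl.mem_nhds (x := (1 : ℝ)) (by simp)
      filter_upwards [nhdsWithin_le_nhds h2, self_mem_nhdsWithin] with s hs hs1 h0
      exact hs ⟨h0, hs1⟩
    exact h1.filter_mono (nhdsWithin_mono _ fun s hs => ne_of_lt hs)
  have hline := eval_update_eq_zero hpτ 0 hε (by
    filter_upwards [hne, Ioo_mem_nhdsLT (show max 0 (1 - ε) < 1 by simpa using hε)]
      with s hs hs1 y hy h0
    have hs0 : 0 < s := (le_max_left _ _).trans_lt hs1.1
    have hsε : 1 - ε < s := (le_max_right _ _).trans_lt hs1.1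
    have hz1 : Function.update (fun k => (s : ℂ) * τ k) 0 y 1 = s * τ 1 := by simp
    refine hs ?_
    rw [← hz1]
    refine hRz _ h0 (hcon _ (by simpa using hy) ?_ ?_ h0)
    · rw [hz1, show (s : ℂ) * τ 1 - τ 1 = ((s - 1 : ℝ) : ℂ) * τ 1 by push_cast; ring, norm_mul,
        hτ 1, mul_one, Complex.norm_real, Real.norm_eq_abs, abs_lt]
      constructor <;> linarith [hs1.2]
    · rw [hz1, norm_mul, hτ 1, mul_one, Complex.norm_real, Real.norm_eq_abs, abs_of_pos hs0]
      exact hs1.2)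
  have hup (x : ℂ) : Function.update τ 0 x = ![x, τ 1] := by
    ext i; fin_cases i <;> simp
  simp only [hup] at hline
  have hqT (x : ℂ) (hx : ‖x‖ = 1) : MvPolynomial.eval ![x, τ 1] q = 0 := by
    have : (![x, τ 1] : Fin 2 → ℂ) ∈ torus := fun i => by
      fin_cases i
      · exact hx
      · exact hτ 1
    simpa [hline x] using hT _ this
  have hq (x : ℂ) : MvPolynomial.eval ![x, τ 1] q = 0 := by
    have hg (y : ℂ) : (MvPolynomial.aeval ![Polynomial.X, Polynomial.C (τ 1)] q).eval y =
        MvPolynomial.eval ![y, τ 1] q := by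
      rw [eval_aeval]
      congr 2
      ext k; fin_cases k <;> simp
    have h0 : MvPolynomial.aeval ![Polynomial.X, Polynomial.C (τ 1)] q = 0 :=
      Polynomial.eq_zero_of_infinite_isRoot _ (infinite_unit_circle.mono fun y hy =>
        (hg y).trans (hqT y hy))
    rw [← hg, h0, Polynomial.eval_zero]
  rcases exists_eval_ne_zero_of_isRelPrime hrel (τ 1) with ⟨x, hx⟩ | ⟨x, hx⟩
  · exact hx (hline x)
  · exact hx (hq x)

/-- A polynomial without zeros on the bidisk and on the torus has no zeros on the closed bidisk. -/
theorem eval_ne_zero_of_closed_bidisk {p : MvPolynomial (Fin 2) ℂ}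
    (hD : ∀ z ∈ bidisk, MvPolynomial.eval z p ≠ 0)
    (hT : ∀ z ∈ torus, MvPolynomial.eval z p ≠ 0) {z : Fin 2 → ℂ} (hz : ∀ i, ‖z i‖ ≤ 1) :
    MvPolynomial.eval z p ≠ 0 := by
  intro h0
  by_cases hzt : z ∈ torus
  · exact hT z hzt h0
  obtain ⟨i, hi⟩ : ∃ i, ‖z i‖ ≠ 1 := by
    by_contra! h
    exact hzt h
  have hlt : ‖z i‖ < 1 := lt_of_le_of_ne (hz i) hi
  have hline := eval_update_eq_zero h0 i (ε := 1 - ‖z i‖) (by linarith) (by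
    filter_upwards [Ioo_mem_nhdsLT (show (0 : ℝ) < 1 by norm_num)] with s hs y hy
    refine hD _ fun k => ?_
    by_cases hk : k = i
    · subst hk
      have := norm_add_le (y - z k) (z k)
      rw [sub_add_cancel] at this
      simp only [Function.update_self]
      linarith
    · rw [Function.update_of_ne hk, norm_mul, Complex.norm_real, Real.norm_eq_abs,
        abs_of_pos hs.1]
      nlinarith [hz k, norm_nonneg (z k), hs.1, hs.2])
  by_cases hdisk : ∀ k, k ≠ i → ‖z k‖ < 1
  · refine hD z (fun k => ?_) h0
    by_cases hk : k = i
    · rwa [hk]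
    · exact hdisk k hk
  · push Not at hdisk
    obtain ⟨k, hki, hk⟩ := hdisk
    refine hT (Function.update z i 1) (fun j => ?_) (hline 1)
    by_cases hj : j = i
    · subst hj; simp
    · have : j = k := by omega
      subst this
      rw [Function.update_of_ne hj]
      exact le_antisymm (hz j) hk

/-! ### Norm comparison of polynomial multipliers -/

theorem orthonormal_monomial :
    Orthonormal ℂ fun b : Fin 2 →₀ ℕ => monomial (b 0, b 1) := by
  rw [orthonormal_iff_ite]
  intro a b
  rw [inner_monomial_left, monomial_apply]
  refine if_congr ⟨fun h => Finsupp.ext fun i => ?_, fun h => by rw [h]⟩ rfl rfl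
  rw [Prod.mk.injEq] at h
  fin_cases i
  · exact h.1
  · exact h.2

theorem norm_sum_smul_eq_of_orthonormal {ι E F : Type*} [NormedAddCommGroup E]
    [InnerProductSpace ℂ E] [NormedAddCommGroup F] [InnerProductSpace ℂ F] {v : ι → E} {w : ι → F}
    (hv : Orthonormal ℂ v) (hw : Orthonormal ℂ w) (s : Finset ι) (c : ι → ℂ) :
    ‖∑ i ∈ s, c i • v i‖ = ‖∑ i ∈ s, c i • w i‖ := by
  have h1 := hv.inner_sum c c s
  rw [← hw.inner_sum c c s, inner_self_eq_norm_sq_to_K, inner_self_eq_norm_sq_to_K] at h1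
  have h2 : ‖∑ i ∈ s, c i • v i‖ ^ 2 = ‖∑ i ∈ s, c i • w i‖ ^ 2 := by exact_mod_cast h1
  exact (pow_left_inj₀ (norm_nonneg _) (norm_nonneg _) two_ne_zero).1 h2

theorem polyOp_monomial_zero (P : MvPolynomial (Fin 2) ℂ) :
    polyOp P (monomial 0) = ∑ b ∈ P.support, P.coeff b • monomial (b 0, b 1) := by
  rw [polyOp_apply]
  refine Finset.sum_congr rfl fun b _ => ?_
  rw [mulMonomial_monomial, add_zero]

theorem norm_polyOp_monomial_zero_le_of_orthonormal {μ : Measure (UnitAddTorus (Fin 2))}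
    [IsFiniteMeasure μ] (hμ : Orthonormal ℂ fun n : Fin 2 → ℤ =>
      ContinuousMap.toLp (E := ℂ) 2 μ ℂ (UnitAddTorus.mFourier n)) {P Q : MvPolynomial (Fin 2) ℂ} {C : ℝ}
    (h : ∀ z ∈ torus, ‖MvPolynomial.eval z P‖ ≤ C * ‖MvPolynomial.eval z Q‖) :
    ‖polyOp P (monomial 0)‖ ≤ C * ‖polyOp Q (monomial 0)‖ := by
  let n : (Fin 2 →₀ ℕ) → Fin 2 → ℤ := fun b i => b i
  have hn : Function.Injective n := fun a b hab => Finsupp.ext fun i => by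
    have h : (a i : ℤ) = b i := congrFun hab i
    exact_mod_cast h
  have hon := hμ.comp n hn
  let F (R : MvPolynomial (Fin 2) ℂ) : C(UnitAddTorus (Fin 2), ℂ) :=
    ∑ b ∈ R.support, R.coeff b • UnitAddTorus.mFourier (n b)
  have hF (R : MvPolynomial (Fin 2) ℂ) (t : UnitAddTorus (Fin 2)) :
      F R t = MvPolynomial.eval (fun i => (fourier 1 (t i) : ℂ)) R := by
    rw [MvPolynomial.eval_eq']
    simp only [F, ContinuousMap.coe_sum, Finset.sum_apply, ContinuousMap.coe_smul, Pi.smul_apply,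
      smul_eq_mul]
    refine Finset.sum_congr rfl fun b _ => ?_
    congr 1
    simp only [UnitAddTorus.mFourier, ContinuousMap.coe_mk]
    refine Finset.prod_congr rfl fun i _ => ?_
    simp only [n, fourier_apply, one_zsmul, natCast_zsmul, AddCircle.toCircle_nsmul, Circle.coe_pow]
  have hnorm (R : MvPolynomial (Fin 2) ℂ) :
      ‖polyOp R (monomial 0)‖ = ‖ContinuousMap.toLp (E := ℂ) 2 μ ℂ (F R)‖ := by
    rw [polyOp_monomial_zero, map_sum]
    simp only [map_smul]
    exact norm_sum_smul_eq_of_orthonormal orthonormal_monomial hon _ _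
  rw [hnorm, hnorm]
  refine Lp.norm_le_mul_norm_of_ae_le_mul ?_
  filter_upwards [ContinuousMap.coeFn_toLp (p := 2) (𝕜 := ℂ) μ (F P), ContinuousMap.coeFn_toLp (p := 2) (𝕜 := ℂ) μ (F Q)] with t h1 h2
  rw [h1, h2, hF, hF]
  exact h _ fun i => by rw [fourier_one]; exact Circle.norm_coe _

theorem norm_polyOp_monomial_zero_le {P Q : MvPolynomial (Fin 2) ℂ} {C : ℝ}
    (h : ∀ z ∈ torus, ‖MvPolynomial.eval z P‖ ≤ C * ‖MvPolynomial.eval z Q‖) :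
    ‖polyOp P (monomial 0)‖ ≤ C * ‖polyOp Q (monomial 0)‖ := by
  let _ : MeasureSpace UnitAddCircle := ⟨AddCircle.haarAddCircle⟩
  have : IsProbabilityMeasure (volume : Measure UnitAddCircle) :=
    inferInstanceAs (IsProbabilityMeasure AddCircle.haarAddCircle)
  exact norm_polyOp_monomial_zero_le_of_orthonormal UnitAddTorus.orthonormal_mFourier h

theorem exists_tendsto_polyOp (f : H2) :
    ∃ F : Finset (ℕ × ℕ) → MvPolynomial (Fin 2) ℂ,
      Tendsto (fun s => polyOp (F s) (monomial 0)) atTop (𝓝 f) := by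
  refine ⟨fun s => ∑ a ∈ s, MvPolynomial.C (f a) *
    (MvPolynomial.X 0 ^ a.1 * MvPolynomial.X 1 ^ a.2), ?_⟩
  have h : HasSum (fun a => lp.single 2 a (f a)) f := lp.hasSum_single (by norm_num) f
  refine h.congr' (Eventually.of_forall fun s => ?_)
  refine ext_of_value fun z hz => ?_
  rw [value_polyOp _ _ hz, value_monomial, ← inner_kernel_left hz, inner_sum, map_sum]
  simp only [Prod.fst_zero, Prod.snd_zero, pow_zero, mul_one]
  refine Finset.sum_congr rfl fun a _ => ?_
  have : lp.single 2 a (f a) = f a • monomial a := by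
    rw [monomial, ← lp.single_smul, smul_eq_mul, mul_one]
  rw [this, inner_smul_right, inner_kernel_left, value_monomial]
  simp

theorem norm_polyOp_le {P Q : MvPolynomial (Fin 2) ℂ} {C : ℝ}
    (h : ∀ z ∈ torus, ‖MvPolynomial.eval z P‖ ≤ C * ‖MvPolynomial.eval z Q‖) (f : H2) :
    ‖polyOp P f‖ ≤ C * ‖polyOp Q f‖ := by
  obtain ⟨F, hF⟩ := exists_tendsto_polyOp f
  refine le_of_tendsto_of_tendsto' (((polyOp P).continuous.tendsto f).comp hF).norm
    ((((polyOp Q).continuous.tendsto f).comp hF).norm.const_mul C) fun s => ?_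
  simp only [Function.comp_apply, ← polyOp_mul]
  refine norm_polyOp_monomial_zero_le fun z hz => ?_
  rw [map_mul, map_mul, norm_mul, norm_mul, ← mul_assoc]
  exact mul_le_mul_of_nonneg_right (h z hz) (norm_nonneg _)

/-! ### Polynomials without zeros on the bidisk are cyclic -/

theorem tendsto_inner_of_tendsto_value {ι : Type*} {l : Filter ι} {X : ι → H2} {M : ℝ}
    (hM : ∀ᶠ r in l, ‖X r‖ ≤ M)
    (hX : ∀ z ∈ bidisk, Tendsto (fun r => (X r).value z) l (𝓝 0)) (y : H2) :
    Tendsto (fun r => inner ℂ y (X r)) l (𝓝 0) := by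
  have hspan : ∀ u ∈ Submodule.span ℂ {k : H2 | ∃ w, ∃ hw : w ∈ bidisk, k = kernel w hw},
      Tendsto (fun r => inner ℂ u (X r)) l (𝓝 0) := by
    intro u hu
    induction hu using Submodule.span_induction with
    | mem u hu =>
      obtain ⟨w, hw, rfl⟩ := hu
      simpa only [inner_kernel_left] using hX w hw
    | zero => simpa only [inner_zero_left] using tendsto_const_nhds
    | add u v _ _ hu hv => simpa only [inner_add_left, add_zero] using hu.add hv
    | smul c u _ hu => simpa only [inner_smul_left, mul_zero] using hu.const_mul (conj c)
  rw [Metric.tendsto_nhds]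
  intro ε hε
  have hM' : 0 < |M| + 1 := by positivity
  obtain ⟨u, hu, hyu⟩ := dense_span_kernel.exists_dist_lt y
    (show 0 < ε / 2 / (|M| + 1) by positivity)
  filter_upwards [hM, (Metric.tendsto_nhds.1 (hspan u hu)) (ε / 2) (by positivity)] with r h1 h2
  rw [dist_zero_right] at h2 ⊢
  have h3 : inner ℂ y (X r) = inner ℂ (y - u) (X r) + inner ℂ u (X r) := by
    rw [inner_sub_left]; ring
  have h4 : ‖inner ℂ (y - u) (X r)‖ ≤ ε / 2 := by
    refine (norm_inner_le_norm _ _).trans ?_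
    rw [dist_eq_norm, lt_div_iff₀ hM'] at hyu
    refine le_trans ?_ hyu.le
    gcongr
    exact h1.trans ((le_abs_self M).trans (by linarith))
  rw [h3]
  exact (norm_add_le _ _).trans_lt (by linarith)

/-- The polynomial `p (r z)`. -/
def dilate (r : ℝ) (p : MvPolynomial (Fin 2) ℂ) : MvPolynomial (Fin 2) ℂ :=
  MvPolynomial.aeval (fun k => MvPolynomial.C (r : ℂ) * MvPolynomial.X k) p

theorem eval_dilate (r : ℝ) (p : MvPolynomial (Fin 2) ℂ) (z : Fin 2 → ℂ) :
    MvPolynomial.eval z (dilate r p) = MvPolynomial.eval (fun k => (r : ℂ) * z k) p := by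
  have h : ((MvPolynomial.aeval z).comp (MvPolynomial.aeval
      fun k => MvPolynomial.C (r : ℂ) * MvPolynomial.X k) : MvPolynomial (Fin 2) ℂ →ₐ[ℂ] ℂ) =
      MvPolynomial.aeval fun k => (r : ℂ) * z k := by
    ext k
    simp
  simpa [dilate, MvPolynomial.aeval_eq_eval] using congrArg (fun φ => φ p) h

theorem norm_ofReal_mul_lt {r : ℝ} (hr0 : 0 < r) (hr1 : r < 1) {x : ℂ} (hx : ‖x‖ ≤ 1) :
    ‖(r : ℂ) * x‖ < 1 := by
  rw [norm_mul, Complex.norm_real, Real.norm_eq_abs, abs_of_pos hr0]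
  nlinarith [norm_nonneg x]

theorem norm_eval_le_mul_norm_eval_dilate {p : MvPolynomial (Fin 2) ℂ}
    (hp : ∀ z ∈ bidisk, MvPolynomial.eval z p ≠ 0) {r : ℝ} (hr0 : 0 < r) (hr1 : r < 1)
    {z : Fin 2 → ℂ} (hz : z ∈ torus) :
    ‖MvPolynomial.eval z p‖ ≤ 2 ^ p.totalDegree * ‖MvPolynomial.eval z (dilate r p)‖ := by
  have h := norm_eval_curve_le (p := p) (fun k => Polynomial.C (z k) * Polynomial.X)
    (fun k => (Polynomial.natDegree_C_mul_le _ _).trans Polynomial.natDegree_X_le) (c := (r : ℂ)) (ε := 1 - r) (by linarith)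
    (fun y hy => hp _ fun k => ?_) 1
  · have h1 : ‖(1 : ℂ) - r‖ = 1 - r := by
      rw [← Complex.ofReal_one, ← Complex.ofReal_sub, Complex.norm_real, Real.norm_eq_abs,
        abs_of_pos (by linarith)]
    rw [h1, div_self (by linarith)] at h
    simp only [Polynomial.eval_mul, Polynomial.eval_C, Polynomial.eval_X, mul_one] at h
    rw [eval_dilate, mul_comm, show (2 : ℝ) = 1 + 1 by norm_num]
    simpa only [mul_comm (r : ℂ)] using h
  · have h1 := norm_add_le (y - r) (r : ℂ)
    rw [sub_add_cancel, Complex.norm_real, Real.norm_eq_abs, abs_of_pos hr0] at h1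
    simp only [Polynomial.eval_mul, Polynomial.eval_C, Polynomial.eval_X]
    rw [norm_mul, hz k, one_mul]
    linarith

theorem denseRange_polyOp {p : MvPolynomial (Fin 2) ℂ}
    (hp : ∀ z ∈ bidisk, MvPolynomial.eval z p ≠ 0) : DenseRange (polyOp p) := by
  have hex : ∀ r : ℝ, ∃ x : H2, 0 < r → r < 1 →
      polyOp (dilate r p) x = monomial 0 := by
    intro r
    by_cases hr : 0 < r ∧ r < 1
    · obtain ⟨u, hu⟩ := isUnit_polyOp (P := dilate r p) fun z hz => by
        rw [eval_dilate]
        exact hp _ fun k => norm_ofReal_mul_lt hr.1 hr.2 (hz k)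
      refine ⟨(↑u⁻¹ : H2 →L[ℂ] H2) (monomial 0), fun _ _ => ?_⟩
      rw [← hu]
      exact congrArg (fun T : H2 →L[ℂ] H2 => T (monomial 0)) u.mul_inv
    · exact ⟨0, fun h1 h2 => absurd ⟨h1, h2⟩ hr⟩
  choose x hx using hex
  have hr : ∀ᶠ r : ℝ in 𝓝[<] 1, 0 < r ∧ r < 1 := Ioo_mem_nhdsLT zero_lt_one
  have hnorm1 : ‖monomial 0‖ = 1 := orthonormal_monomial.1 0
  have hbound : ∀ᶠ r : ℝ in 𝓝[<] 1, ‖polyOp p (x r) - monomial 0‖ ≤ 2 ^ p.totalDegree + 1 := by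
    filter_upwards [hr] with r hr
    refine (norm_sub_le _ _).trans ?_
    have := norm_polyOp_le (fun z hz => norm_eval_le_mul_norm_eval_dilate hp hr.1 hr.2 hz) (x r)
    rw [hx r hr.1 hr.2, hnorm1, mul_one] at this
    rw [hnorm1]
    linarith
  have hval : ∀ z ∈ bidisk, Tendsto (fun r => (polyOp p (x r) - monomial 0).value z) (𝓝[<] 1)
      (𝓝 0) := by
    intro z hz
    have h1 : Continuous fun r : ℝ => MvPolynomial.eval (fun k => (r : ℂ) * z k) p :=
      (continuous_eval_mvPolynomial p).comp (continuous_pi fun k => by fun_prop)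
    have h2 : Tendsto (fun r : ℝ => MvPolynomial.eval z p /
        MvPolynomial.eval (fun k => (r : ℂ) * z k) p - 1) (𝓝[<] 1) (𝓝 0) := by
      have h3 := (h1.tendsto 1).mono_left (nhdsWithin_le_nhds (s := Set.Iio 1))
      simp only [Complex.ofReal_one, one_mul] at h3
      have h4 := ((tendsto_const_nhds (x := MvPolynomial.eval z p)).div h3 (hp z hz)).sub_const 1
      rwa [div_self (hp z hz), sub_self] at h4
    refine h2.congr' ?_
    filter_upwards [hr] with r hr
    have h3 := congrArg (fun f => H2.value f z) (hx r hr.1 hr.2)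
    simp only [value_polyOp _ _ hz, eval_dilate, value_monomial, Prod.fst_zero, Prod.snd_zero,
      pow_zero, mul_one] at h3
    have h4 : MvPolynomial.eval (fun k => (r : ℂ) * z k) p ≠ 0 := left_ne_zero_of_mul_eq_one h3
    rw [H2.value_sub _ _ hz, value_polyOp _ _ hz, value_monomial]
    simp only [Prod.fst_zero, Prod.snd_zero, pow_zero, mul_one]
    rw [div_eq_mul_inv, ← eq_inv_of_mul_eq_one_right h3]
  have horth : (LinearMap.range (polyOp p).toLinearMap)ᗮ = ⊥ := by
    rw [Submodule.eq_bot_iff]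
    intro h hh
    ext a
    have h1 := tendsto_inner_of_tendsto_value hbound hval (backShift a h)
    have h2 : ∀ r, inner ℂ (backShift a h) (polyOp p (x r) - monomial 0) =
        - inner ℂ h (monomial a) := fun r => by
      rw [inner_sub_right, inner_backShift_left, inner_backShift_left, mulMonomial_monomial,
        add_zero, ← polyOp_mulMonomial, show inner ℂ h (polyOp p _) = 0 from
          Submodule.inner_left_of_mem_orthogonal (LinearMap.mem_range_self _ _) hh, zero_sub]
    simp only [h2] at h1
    have h3 := tendsto_nhds_unique h1 tendsto_const_nhds
    rw [← inner_monomial_left, ← inner_conj_symm, neg_eq_zero.1 h3.symm]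
    simp
  have := (Submodule.topologicalClosure_eq_top_iff).2 horth
  rw [← Submodule.dense_iff_topologicalClosure_eq_top] at this
  exact this

/-! ### Rational inner functions in lowest terms -/

/-- `Θ = q / p` in lowest terms, where `q` is `c` times the reflection of `p` of degree `N`. -/
structure IsReducedForm (Θ : (Fin 2 → ℂ) → ℂ) (p q : MvPolynomial (Fin 2) ℂ) (N : ℕ × ℕ)
    (c : ℂ) : Prop where
  eval_ne_zero : ∀ z ∈ bidisk, MvPolynomial.eval z p ≠ 0
  eq_div : ∀ z ∈ bidisk, Θ z = MvPolynomial.eval z q / MvPolynomial.eval z p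
  isRelPrime : IsRelPrime p q
  norm_eval_eq : ∀ z ∈ torus, ‖MvPolynomial.eval z q‖ = ‖MvPolynomial.eval z p‖
  degree_le : ∀ b ∈ p.support, b 0 ≤ N.1 ∧ b 1 ≤ N.2
  const_ne_zero : c ≠ 0
  eval_eq : ∀ z, MvPolynomial.eval z q =
    c * ∑ b ∈ p.support, conj (p.coeff b) * (z 0 ^ (N.1 - b 0) * z 1 ^ (N.2 - b 1))

theorem zero_mem_bidisk : (0 : Fin 2 → ℂ) ∈ bidisk := fun i => by simp

theorem exists_isReducedForm {Θ : (Fin 2 → ℂ) → ℂ} {m n : ℕ} (hinner : IsInner Θ)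
    (hdeg : IsRationalOfDegree Θ m n) : ∃ p q c, IsReducedForm Θ p q (m, n) c := by
  obtain ⟨p, q, hrel, hpq, hm, hn⟩ := hdeg
  have hp : p ≠ 0 := by
    rintro rfl
    exact (hpq 0 zero_mem_bidisk).1 (map_zero _)
  let N : Fin 2 →₀ ℕ := Finsupp.equivFunOnFinite.symm ![m, n]
  have hN : ∀ i, max (p.degreeOf i) (q.degreeOf i) = N i := by
    intro i
    fin_cases i
    · exact hm
    · exact hn
  have hT (z) (hz : z ∈ torus) := norm_eval_eq_of_isInner hinner hpq hz
  obtain ⟨c, hc, hq⟩ := exists_eval_eq_mul_eval_reflect hp hrel hT hN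
  refine ⟨p, q, c, fun z hz => (hpq z hz).1, fun z hz => (hpq z hz).2, hrel, hT, fun b hb => ?_,
    norm_ne_zero_iff.1 (by rw [hc]; exact one_ne_zero), fun z => ?_⟩
  · exact ⟨(MvPolynomial.degreeOf_le_iff.1 ((le_max_left _ _).trans_eq hm)) b hb,
      (MvPolynomial.degreeOf_le_iff.1 ((le_max_left _ _).trans_eq hn)) b hb⟩
  · rw [hq, eval_reflect]
    rfl

section

variable {Θ : (Fin 2 → ℂ) → ℂ} {p q : MvPolynomial (Fin 2) ℂ} {N : ℕ × ℕ} {c : ℂ}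

theorem IsReducedForm.ne_zero (h : IsReducedForm Θ p q N c) : p ≠ 0 := by
  rintro rfl
  exact h.eval_ne_zero 0 zero_mem_bidisk (map_zero _)

theorem IsReducedForm.polyOp_eq (h : IsReducedForm Θ p q N c) (f : H2) :
    polyOp q f = c • ∑ b ∈ p.support,
      conj (p.coeff b) • mulMonomial (N.1 - b 0, N.2 - b 1) f :=
  ext_of_value fun z hz => by
    rw [value_polyOp _ _ hz, h.eval_eq, H2.value_smul _ _ hz,
      ← inner_kernel_left hz, ← inner_kernel_left hz, inner_sum, mul_assoc, Finset.sum_mul]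
    congr 1
    refine Finset.sum_congr rfl fun b _ => ?_
    simp only [inner_smul_right, inner_kernel_left, value_mulMonomial]
    ring

theorem IsReducedForm.inner_polyOp (h : IsReducedForm Θ p q N c) {k : ℕ × ℕ} (hk : k ≤ N)
    (f g : H2) : inner ℂ (polyOp q g) (mulMonomial k f) =
      conj c * inner ℂ g (backShift (N - k) (polyOp p f)) := by
  rw [h.polyOp_eq, inner_smul_left, sum_inner, polyOp_apply, map_sum, inner_sum]
  congr 1
  refine Finset.sum_congr rfl fun b hb => ?_
  have hb' := h.degree_le b hb
  rw [inner_smul_left, Complex.conj_conj, map_smul, inner_smul_right, ← inner_backShift_right,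
    backShift_mulMonomial (u := N - k) (v := (b 0, b 1))]
  have h1 := hk.1
  have h2 := hk.2
  ext <;> simp <;> omega

theorem IsReducedForm.polyOp_mem_rangeMul (h : IsReducedForm Θ p q N c) (f : H2) :
    polyOp q f ∈ rangeMul Θ :=
  ⟨polyOp p f, fun z hz => by
    rw [value_polyOp _ _ hz, value_polyOp _ _ hz, h.eq_div z hz, ← mul_assoc,
      div_mul_cancel₀ _ (h.eval_ne_zero z hz)]⟩

theorem IsReducedForm.backShift_polyOp_eq_zero (h : IsReducedForm Θ p q N c) {k : ℕ × ℕ}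
    (hk : k ≤ N) {f : H2} (hf : mulMonomial k f ∈ modelSpace Θ) :
    backShift (N - k) (polyOp p f) = 0 := by
  refine ext_inner_left ℂ fun g => ?_
  have h1 := h.inner_polyOp hk f g
  rw [Submodule.inner_right_of_mem_orthogonal (h.polyOp_mem_rangeMul g) hf] at h1
  rw [inner_zero_right]
  exact (mul_eq_zero.1 h1.symm).resolve_left (by simpa using h.const_ne_zero)

theorem mulMonomial_snd_mem {S : Submodule ℂ H2} (hS : ∀ f ∈ S, Mz2 f ∈ S) (n : ℕ) {f : H2}
    (hf : f ∈ S) : mulMonomial (0, n) f ∈ S := by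
  induction n with
  | zero =>
    have : mulMonomial (0, 0) f = f := ext_of_value fun z _ => by simp [value_mulMonomial]
    rwa [this]
  | succ n ih =>
    have := hS _ ih
    rwa [Mz2, mulMonomial_mulMonomial, Prod.mk_add_mk, zero_add, add_comm] at this

theorem mulMonomial_fst_mem {S : Submodule ℂ H2} (hS : ∀ f ∈ S, Mz1 f ∈ S) (n : ℕ) {f : H2}
    (hf : f ∈ S) : mulMonomial (n, 0) f ∈ S := by
  induction n with
  | zero =>
    have : mulMonomial (0, 0) f = f := ext_of_value fun z _ => by simp [value_mulMonomial]
    rwa [this]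
  | succ n ih =>
    have := hS _ ih
    rwa [Mz1, mulMonomial_mulMonomial, Prod.mk_add_mk, zero_add, add_comm] at this

theorem IsReducedForm.backShift_polyOp_of_mem₂ {S₁ S₂ : Submodule ℂ H2}
    (h : IsReducedForm Θ p q N c) (hS : IsShiftDecomposition Θ S₁ S₂) {f : H2} (hf : f ∈ S₂) :
    backShift (N.1, 0) (polyOp p f) = 0 := by
  have h1 : mulMonomial (0, N.2) f ∈ modelSpace Θ := by
    rw [← hS.sup_eq]
    exact Submodule.mem_sup_right (mulMonomial_snd_mem hS.invariant₂ _ hf)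
  have h2 := h.backShift_polyOp_eq_zero (k := (0, N.2)) ⟨Nat.zero_le _, le_rfl⟩ h1
  rwa [show N - (0, N.2) = (N.1, 0) by ext <;> simp] at h2

theorem IsReducedForm.backShift_polyOp_of_mem₁ {S₁ S₂ : Submodule ℂ H2}
    (h : IsReducedForm Θ p q N c) (hS : IsShiftDecomposition Θ S₁ S₂) {f : H2} (hf : f ∈ S₁) :
    backShift (0, N.2) (polyOp p f) = 0 := by
  have h1 : mulMonomial (N.1, 0) f ∈ modelSpace Θ := by
    rw [← hS.sup_eq]
    exact Submodule.mem_sup_left (mulMonomial_fst_mem hS.invariant₁ _ hf)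
  have h2 := h.backShift_polyOp_eq_zero (k := (N.1, 0)) ⟨le_rfl, Nat.zero_le _⟩ h1
  rwa [show N - (N.1, 0) = (0, N.2) by ext <;> simp] at h2

/-! ### The numerical radius of the compressed shift -/

theorem inner_compressedShift (S : Submodule ℂ H2) [S.HasOrthogonalProjection] (h g : S) :
    inner ℂ h (compressedShift S g) = inner ℂ (h : H2) (mulMonomial (1, 0) (g : H2)) := by
  rw [Submodule.coe_inner]
  change inner ℂ (h : H2) (S.starProjection (Mz1 g)) = _
  rw [← Submodule.inner_starProjection_left_eq_right, Submodule.starProjection_eq_self_iff.2 h.2]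
  rfl

theorem norm_inner_compressedShift_le (S : Submodule ℂ H2) [S.HasOrthogonalProjection] (h : S) :
    ‖inner ℂ h (compressedShift S h)‖ ≤ ‖h‖ * ‖h‖ := by
  rw [inner_compressedShift]
  refine (norm_inner_le_norm _ _).trans ?_
  rw [(mulMonomial (1, 0)).norm_map]
  rfl

theorem bddAbove_numericalRange (S : Submodule ℂ H2) [S.HasOrthogonalProjection] :
    BddAbove ((fun c : ℂ => ‖c‖) '' numericalRange (compressedShift S)) := by
  refine ⟨1, ?_⟩
  rintro _ ⟨_, ⟨h, hh, rfl⟩, rfl⟩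
  simpa [hh] using norm_inner_compressedShift_le S h

theorem numericalRadius_le_one (S : Submodule ℂ H2) [S.HasOrthogonalProjection] :
    numericalRadius (compressedShift S) ≤ 1 := by
  refine Real.sSup_le ?_ zero_le_one
  rintro _ ⟨_, ⟨h, hh, rfl⟩, rfl⟩
  simpa [hh] using norm_inner_compressedShift_le S h

theorem numericalRadius_nonneg (S : Submodule ℂ H2) [S.HasOrthogonalProjection] :
    0 ≤ numericalRadius (compressedShift S) := by
  refine Real.sSup_nonneg ?_
  rintro _ ⟨_, _, rfl⟩
  exact norm_nonneg _

theorem norm_inner_le_numericalRadius (S : Submodule ℂ H2) [S.HasOrthogonalProjection] (h : S) :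
    ‖inner ℂ (h : H2) (mulMonomial (1, 0) (h : H2))‖ ≤
      numericalRadius (compressedShift S) * ‖h‖ ^ 2 := by
  by_cases h0 : h = 0
  · simp [h0]
  have hn : ‖h‖ ≠ 0 := norm_ne_zero_iff.2 h0
  rw [← inner_compressedShift]
  let g : S := ((‖h‖⁻¹ : ℝ) : ℂ) • h
  have hg : ‖g‖ = 1 := by
    simp only [g]
    rw [norm_smul, Complex.norm_real, norm_inv, norm_norm, inv_mul_cancel₀ hn]
  have h1 : ‖inner ℂ g (compressedShift S g)‖ ≤ numericalRadius (compressedShift S) :=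
    le_csSup (bddAbove_numericalRange S) ⟨_, ⟨g, hg, rfl⟩, rfl⟩
  have h2 : inner ℂ g (compressedShift S g) =
      ((‖h‖⁻¹ ^ 2 : ℝ) : ℂ) * inner ℂ h (compressedShift S h) := by
    rw [inner_compressedShift, inner_compressedShift, Submodule.coe_smul, map_smul,
      inner_smul_left, inner_smul_right, Complex.conj_ofReal]
    push_cast
    ring
  rw [h2, norm_mul, Complex.norm_real, Real.norm_eq_abs, abs_of_nonneg (by positivity), inv_pow,
    inv_mul_le_iff₀ (by positivity)] at h1
  linarith

/-! ### Regular functions: the numerical radius is less than one -/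

theorem norm_mulMonomial_sub_le {l : ℂ} (hl : ‖l‖ = 1) (g : H2) (k : ℕ) :
    ‖mulMonomial (k, 0) g - l ^ k • g‖ ≤ k * ‖mulMonomial (1, 0) g - l • g‖ := by
  induction k with
  | zero =>
    have : mulMonomial (0, 0) g = g := ext_of_value fun z _ => by simp [value_mulMonomial]
    simp [this]
  | succ k ih =>
    have h1 : mulMonomial (k + 1, 0) g - l ^ (k + 1) • g =
        mulMonomial (k, 0) (mulMonomial (1, 0) g - l • g) +
          l • (mulMonomial (k, 0) g - l ^ k • g) := by
      rw [map_sub, map_smul, mulMonomial_mulMonomial, Prod.mk_add_mk, add_zero, smul_sub, smul_smul,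
        pow_succ']
      abel
    rw [h1]
    refine (norm_add_le _ _).trans ?_
    rw [LinearIsometry.norm_map, norm_smul, hl, one_mul]
    push_cast
    linarith

theorem norm_le_mul_norm_of_backShift_eq_zero {l : ℂ} (hl : ‖l‖ = 1) {g : H2} {m : ℕ}
    (hg : backShift (m, 0) g = 0) : ‖g‖ ≤ m * ‖mulMonomial (1, 0) g - l • g‖ := by
  refine le_trans ?_ (norm_mulMonomial_sub_le hl g m)
  have h0 : inner ℂ (mulMonomial (m, 0) g) (l ^ m • g) = 0 := by
    rw [inner_smul_right, ← inner_backShift_right, hg, inner_zero_right, mul_zero]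
  have h1 := norm_sub_sq (𝕜 := ℂ) (mulMonomial (m, 0) g) (l ^ m • g)
  rw [h0, map_zero, mul_zero, sub_zero, LinearIsometry.norm_map, norm_smul, norm_pow, hl, one_pow,
    one_mul] at h1
  refine le_of_sq_le_sq ?_ (norm_nonneg _)
  rw [h1]
  nlinarith [sq_nonneg ‖g‖]

theorem norm_sub_smul_sq {h : H2} (hh : ‖h‖ = 1) : ∃ l : ℂ, ‖l‖ = 1 ∧
    ‖mulMonomial (1, 0) h - l • h‖ ^ 2 = 2 - 2 * ‖inner ℂ h (mulMonomial (1, 0) h)‖ := by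
  obtain ⟨l, hl, hlx⟩ : ∃ l : ℂ, ‖l‖ = 1 ∧
      conj l * inner ℂ h (mulMonomial (1, 0) h) = (‖inner ℂ h (mulMonomial (1, 0) h)‖ : ℂ) := by
    generalize inner ℂ h (mulMonomial (1, 0) h) = x
    by_cases hx : x = 0
    · exact ⟨1, by simp, by simp [hx]⟩
    · have hn : (‖x‖ : ℂ) ≠ 0 := by simpa using hx
      refine ⟨x / ‖x‖, by simp [hx], ?_⟩
      rw [map_div₀, Complex.conj_ofReal, div_mul_eq_mul_div, mul_comm, Complex.mul_conj,
        Complex.normSq_eq_norm_sq, div_eq_iff hn]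
      push_cast
      ring
  refine ⟨l, hl, ?_⟩
  rw [norm_sub_rev, norm_sub_sq (𝕜 := ℂ), inner_smul_left, hlx, norm_smul, hl,
    LinearIsometry.norm_map, hh]
  simp
  ring

theorem IsReducedForm.numericalRadius_lt_one {S₁ S₂ : Submodule ℂ H2}
    [S₂.HasOrthogonalProjection] (h : IsReducedForm Θ p q N c)
    (hS : IsShiftDecomposition Θ S₁ S₂) (hT : ∀ z ∈ torus, MvPolynomial.eval z p ≠ 0) :
    numericalRadius (compressedShift S₂) < 1 := by
  obtain ⟨C, hC, hCf⟩ := exists_norm_le_mul_norm_polyOp (P := p)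
    fun z hz => eval_ne_zero_of_closed_bidisk h.eval_ne_zero hT hz
  let D : ℝ := C * (N.1 * ‖polyOp p‖) + 1
  have hD : 1 ≤ D := by
    have : 0 ≤ C * (N.1 * ‖polyOp p‖) := by positivity
    simp only [D]; linarith
  have key : ∀ f ∈ S₂, ∀ l : ℂ, ‖l‖ = 1 → ‖f‖ ≤ D * ‖mulMonomial (1, 0) f - l • f‖ := by
    intro f hf l hl
    have h1 := norm_le_mul_norm_of_backShift_eq_zero hl (h.backShift_polyOp_of_mem₂ hS hf)
    rw [← polyOp_mulMonomial, ← map_smul, ← map_sub] at h1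
    have h2 := (polyOp p).le_opNorm (mulMonomial (1, 0) f - l • f)
    calc ‖f‖ ≤ C * ‖polyOp p f‖ := hCf f
      _ ≤ C * (N.1 * (‖polyOp p‖ * ‖mulMonomial (1, 0) f - l • f‖)) := by
        gcongr
        exact h1.trans (by gcongr)
      _ = C * (N.1 * ‖polyOp p‖) * ‖mulMonomial (1, 0) f - l • f‖ := by ring
      _ ≤ D * ‖mulMonomial (1, 0) f - l • f‖ := by
        gcongr
        simp [D]
  have hw : numericalRadius (compressedShift S₂) ≤ 1 - 1 / (2 * D ^ 2) := by
    refine Real.sSup_le ?_ ?_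
    · rintro _ ⟨_, ⟨g, hg, rfl⟩, rfl⟩
      obtain ⟨l, hl, hlg⟩ := norm_sub_smul_sq (h := (g : H2)) hg
      have h1 := key g g.2 l hl
      rw [show ‖(g : H2)‖ = 1 from hg] at h1
      have h2 : 1 ≤ D ^ 2 * ‖mulMonomial (1, 0) (g : H2) - l • (g : H2)‖ ^ 2 := by
        rw [← mul_pow]
        exact one_le_pow₀ h1
      rw [hlg] at h2
      simp only [inner_compressedShift]
      have h3 : 0 < D ^ 2 := by positivity
      rw [le_sub_iff_add_le, ← le_sub_iff_add_le', div_le_iff₀ (by positivity)]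
      linarith
    · have : 1 / (2 * D ^ 2) ≤ 1 := by
        rw [div_le_one (by positivity)]
        nlinarith
      linarith
  have : 0 < 1 / (2 * D ^ 2) := by positivity
  linarith

end

section

variable {Θ : (Fin 2 → ℂ) → ℂ} {p q : MvPolynomial (Fin 2) ℂ} {N : ℕ × ℕ} {c : ℂ}

/-! ### Multiplication by a rational inner function -/

theorem IsReducedForm.exists_isometry (h : IsReducedForm Θ p q N c) :
    ∃ M : H2 →ₗᵢ[ℂ] H2, ∀ f, ∀ z ∈ bidisk, (M f).value z = Θ z * f.value z := by
  have hd : DenseRange (polyOp p).toLinearMap := denseRange_polyOp h.eval_ne_zero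
  have hle (f : H2) : ‖(polyOp q).toLinearMap f‖ ≤ 1 * ‖(polyOp p).toLinearMap f‖ :=
    norm_polyOp_le (fun z hz => by rw [one_mul, h.norm_eval_eq z hz]) f
  have hge (f : H2) : ‖polyOp p f‖ ≤ 1 * ‖polyOp q f‖ :=
    norm_polyOp_le (fun z hz => by rw [one_mul, h.norm_eval_eq z hz]) f
  let M : H2 →L[ℂ] H2 := (polyOp q).toLinearMap.extendOfNorm (polyOp p).toLinearMap
  have hM (f : H2) : M (polyOp p f) = polyOp q f :=
    LinearMap.extendOfNorm_eq hd ⟨1, hle⟩ f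
  have hnorm (f : H2) : ‖M f‖ = ‖f‖ := by
    refine hd.induction_on (p := fun f => ‖M f‖ = ‖f‖) f
      (isClosed_eq (by fun_prop) (by fun_prop)) fun g => ?_
    change ‖M (polyOp p g)‖ = ‖polyOp p g‖
    rw [hM]
    exact le_antisymm (by simpa using hle g) (by simpa using hge g)
  refine ⟨⟨M.toLinearMap, hnorm⟩, fun f z hz => ?_⟩
  change (M f).value z = _
  rw [← inner_kernel_left hz, ← inner_kernel_left hz]
  refine hd.induction_on
    (p := fun f => inner ℂ (kernel z hz) (M f) = Θ z * inner ℂ (kernel z hz) f) f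
    (isClosed_eq (by fun_prop) (by fun_prop)) fun g => ?_
  change inner ℂ (kernel z hz) (M (polyOp p g)) = Θ z * inner ℂ (kernel z hz) (polyOp p g)
  rw [hM, inner_kernel_left, inner_kernel_left, value_polyOp _ _ hz, value_polyOp _ _ hz,
    h.eq_div z hz, ← mul_assoc, div_mul_cancel₀ _ (h.eval_ne_zero z hz)]

/-- The reproducing kernel of the model space. -/
theorem IsReducedForm.exists_mem_modelSpace (h : IsReducedForm Θ p q N c) {w : Fin 2 → ℂ}
    (hw : w ∈ bidisk) : ∃ v ∈ modelSpace Θ,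
      (∀ f ∈ modelSpace Θ, inner ℂ f v = inner ℂ f (kernel w hw)) ∧
      ∀ z ∈ bidisk, v.value z = (1 - Θ z * conj (Θ w)) * (kernel w hw).value z := by
  obtain ⟨M, hM⟩ := h.exists_isometry
  have hmem : M (kernel w hw) ∈ rangeMul Θ := ⟨kernel w hw, hM _⟩
  refine ⟨kernel w hw - conj (Θ w) • M (kernel w hw), ?_, fun f hf => ?_, fun z hz => ?_⟩
  · rintro g ⟨f, hf⟩
    obtain rfl : g = M f := ext_of_value fun z hz => by rw [hf z hz, hM f z hz]
    rw [inner_sub_right, inner_smul_right, LinearIsometry.inner_map_map,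
      ← inner_conj_symm _ (kernel w hw), ← inner_conj_symm f (kernel w hw), inner_kernel_left,
      inner_kernel_left, hM _ w hw, map_mul, sub_self]
  · rw [inner_sub_right, inner_smul_right, Submodule.inner_left_of_mem_orthogonal hmem hf,
      mul_zero, sub_zero]
  · rw [H2.value_sub _ _ hz, H2.value_smul _ _ hz, hM _ z hz]
    ring

/-! ### Invariance under backward shifts -/

theorem mulMonomial_backShift_comm {d e : ℕ × ℕ} (h₁ : d.1 = 0 ∨ e.1 = 0)
    (h₂ : d.2 = 0 ∨ e.2 = 0) (f : H2) :
    mulMonomial e (backShift d f) = backShift d (mulMonomial e f) := by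
  ext ⟨a₁, a₂⟩
  obtain ⟨d₁, d₂⟩ := d
  obtain ⟨e₁, e₂⟩ := e
  simp only [backShift_apply, mulMonomial_apply, Prod.mk_le_mk, Prod.mk_sub_mk, Prod.mk_add_mk]
  simp only at h₁ h₂
  split_ifs <;> first | exact f.apply_congr (by simp; omega) (by simp; omega) | omega | rfl

theorem backShift_mem_modelSpace (d : ℕ × ℕ) {f : H2} (hf : f ∈ modelSpace Θ) :
    backShift d f ∈ modelSpace Θ := by
  rintro g ⟨u, hu⟩
  rw [inner_backShift_right]
  refine hf _ ⟨mulMonomial d u, fun z hz => ?_⟩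
  rw [value_mulMonomial, value_mulMonomial, hu z hz]
  ring

variable {S₁ S₂ : Submodule ℂ H2}

theorem IsShiftDecomposition.mem₁ (hS : IsShiftDecomposition Θ S₁ S₂) {f : H2}
    (hf : f ∈ modelSpace Θ) (hf' : ∀ g ∈ S₂, inner ℂ g f = 0) : f ∈ S₁ := by
  rw [← hS.sup_eq] at hf
  obtain ⟨u, hu, v, hv, rfl⟩ := Submodule.mem_sup.1 hf
  have h1 := hf' v hv
  rw [inner_add_right, Submodule.IsOrtho.inner_eq hS.orthogonal.symm hv hu, zero_add,
    inner_self_eq_zero] at h1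
  rwa [h1, add_zero]

theorem IsShiftDecomposition.mem₂ (hS : IsShiftDecomposition Θ S₁ S₂) {f : H2}
    (hf : f ∈ modelSpace Θ) (hf' : ∀ g ∈ S₁, inner ℂ g f = 0) : f ∈ S₂ := by
  rw [← hS.sup_eq] at hf
  obtain ⟨u, hu, v, hv, rfl⟩ := Submodule.mem_sup.1 hf
  have h1 := hf' u hu
  rw [inner_add_right, Submodule.IsOrtho.inner_eq hS.orthogonal hu hv, add_zero,
    inner_self_eq_zero] at h1
  rwa [h1, zero_add]

theorem IsShiftDecomposition.le₁ (hS : IsShiftDecomposition Θ S₁ S₂) : S₁ ≤ modelSpace Θ :=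
  le_sup_left.trans hS.sup_eq.le

theorem IsShiftDecomposition.le₂ (hS : IsShiftDecomposition Θ S₁ S₂) : S₂ ≤ modelSpace Θ :=
  le_sup_right.trans hS.sup_eq.le

theorem IsShiftDecomposition.backShift_mem₂ (hS : IsShiftDecomposition Θ S₁ S₂) {f : H2}
    (hf : f ∈ S₂) : backShift (1, 0) f ∈ S₂ :=
  hS.mem₂ (backShift_mem_modelSpace _ (hS.le₂ hf)) fun g hg => by
    rw [inner_backShift_right]
    exact Submodule.IsOrtho.inner_eq hS.orthogonal (hS.invariant₁ g hg) hf

/-! ### The wandering subspaces -/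

/-- The wandering subspace `S ⊖ z^d S`. -/
def wandering (S : Submodule ℂ H2) (d : ℕ × ℕ) : Submodule ℂ H2 :=
  S ⊓ (S.map (mulMonomial d).toLinearMap)ᗮ

theorem mem_wandering {S : Submodule ℂ H2} {d : ℕ × ℕ} {f : H2} :
    f ∈ wandering S d ↔ f ∈ S ∧ ∀ g ∈ S, inner ℂ (mulMonomial d g) f = 0 := by
  refine and_congr_right fun _ => ?_
  rw [SetLike.mem_coe, Submodule.mem_orthogonal]
  refine ⟨fun h g hg => h _ (Submodule.mem_map_of_mem hg), ?_⟩
  rintro h _ ⟨g, hg, rfl⟩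
  exact h g hg

theorem IsReducedForm.backShift_polyOp_add_eq_zero (h : IsReducedForm Θ p q N c) {k d : ℕ × ℕ}
    (hk : k ≤ N) (h₁ : d.1 = 0 ∨ k.1 = 0) (h₂ : d.2 = 0 ∨ k.2 = 0) {f : H2}
    (hf : mulMonomial k (backShift d f) ∈ modelSpace Θ) :
    backShift (d + (N - k)) (polyOp p f) = 0 := by
  refine ext_inner_left ℂ fun g => ?_
  have h1 := Submodule.inner_right_of_mem_orthogonal (h.polyOp_mem_rangeMul g) hf
  rw [mulMonomial_backShift_comm h₁ h₂, inner_backShift_right, ← polyOp_mulMonomial,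
    h.inner_polyOp hk, ← inner_backShift_right, backShift_backShift] at h1
  rw [inner_zero_right]
  exact (mul_eq_zero.1 h1).resolve_left (by simpa using h.const_ne_zero)

theorem IsReducedForm.polyOp_apply_of_mem_wandering₁ (h : IsReducedForm Θ p q N c)
    (hS : IsShiftDecomposition Θ S₁ S₂) {f : H2} (hf : f ∈ wandering S₁ (1, 0)) (a : ℕ × ℕ)
    (ha : ¬ a ≤ N) : polyOp p f a = 0 := by
  rw [mem_wandering] at hf
  have h1 : backShift (1, 0) f ∈ S₂ :=
    hS.mem₂ (backShift_mem_modelSpace _ (hS.le₁ hf.1)) fun g hg => by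
      rw [inner_backShift_right]
      exact hf.2 g hg
  have h2 := h.backShift_polyOp_add_eq_zero (k := (0, N.2)) (d := (1, 0))
    ⟨Nat.zero_le _, le_rfl⟩ (Or.inr rfl) (Or.inl rfl)
    (hS.le₂ (mulMonomial_snd_mem hS.invariant₂ _ h1))
  have h3 := h.backShift_polyOp_of_mem₁ hS hf.1
  obtain ⟨a₁, a₂⟩ := a
  by_cases ha2 : N.2 ≤ a₂
  · have := congrArg (fun f : H2 => (f (a₁, a₂ - N.2) : ℂ)) h3
    simp only [backShift_apply] at this
    rw [← (polyOp p f).apply_congr (a := (0, N.2) + (a₁, a₂ - N.2)) (by simp) (by simp; omega)]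
    exact this
  · have ha1 : N.1 < a₁ := by
      by_contra hcon
      exact ha ⟨by simp; omega, by simp; omega⟩
    have := congrArg (fun f : H2 => (f (a₁ - (N.1 + 1), a₂) : ℂ)) h2
    simp only [backShift_apply] at this
    rw [← (polyOp p f).apply_congr (a := (1, 0) + (N - (0, N.2)) + (a₁ - (N.1 + 1), a₂))
      (by simp; omega) (by simp)]
    exact this

theorem IsReducedForm.polyOp_apply_of_mem_wandering₂ (h : IsReducedForm Θ p q N c)
    (hS : IsShiftDecomposition Θ S₁ S₂) {f : H2} (hf : f ∈ wandering S₂ (0, 1)) (a : ℕ × ℕ)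
    (ha : ¬ a ≤ N) : polyOp p f a = 0 := by
  rw [mem_wandering] at hf
  have h1 : backShift (0, 1) f ∈ S₁ :=
    hS.mem₁ (backShift_mem_modelSpace _ (hS.le₂ hf.1)) fun g hg => by
      rw [inner_backShift_right]
      exact hf.2 g hg
  have h2 := h.backShift_polyOp_add_eq_zero (k := (N.1, 0)) (d := (0, 1))
    ⟨le_rfl, Nat.zero_le _⟩ (Or.inl rfl) (Or.inr rfl)
    (hS.le₁ (mulMonomial_fst_mem hS.invariant₁ _ h1))
  have h3 := h.backShift_polyOp_of_mem₂ hS hf.1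
  obtain ⟨a₁, a₂⟩ := a
  by_cases ha1 : N.1 ≤ a₁
  · have := congrArg (fun f : H2 => (f (a₁ - N.1, a₂) : ℂ)) h3
    simp only [backShift_apply] at this
    rw [← (polyOp p f).apply_congr (a := (N.1, 0) + (a₁ - N.1, a₂)) (by simp; omega) (by simp)]
    exact this
  · have ha2 : N.2 < a₂ := by
      by_contra hcon
      exact ha ⟨by simp; omega, by simp; omega⟩
    have := congrArg (fun f : H2 => (f (a₁, a₂ - (N.2 + 1)) : ℂ)) h2
    simp only [backShift_apply] at this
    rw [← (polyOp p f).apply_congr (a := (0, 1) + (N - (N.1, 0)) + (a₁, a₂ - (N.2 + 1)))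
      (by simp) (by simp; omega)]
    exact this

theorem finiteDimensional_of_polyOp_apply_eq_zero {E : Submodule ℂ H2}
    (hp : ∀ z ∈ bidisk, MvPolynomial.eval z p ≠ 0)
    (hE : ∀ f ∈ E, ∀ a, ¬ a ≤ N → polyOp p f a = 0) : FiniteDimensional ℂ E := by
  let φ : E →ₗ[ℂ] (Finset.Iic N → ℂ) :=
    { toFun f a := polyOp p (f : H2) a
      map_add' f g := by ext a; simp
      map_smul' r f := by ext a; simp }
  refine FiniteDimensional.of_injective φ fun f g hfg => Subtype.ext (polyOp_injective hp ?_)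
  ext a
  by_cases ha : a ≤ N
  · exact congrFun hfg ⟨a, Finset.mem_Iic.2 ha⟩
  · rw [hE f f.2 a ha, hE g g.2 a ha]

theorem exists_eval_eq_value {g : H2} (hg : ∀ a, ¬ a ≤ N → g a = 0) :
    ∃ F : MvPolynomial (Fin 2) ℂ, ∀ z, MvPolynomial.eval z F = g.value z := by
  refine ⟨∑ a ∈ Finset.Iic N, MvPolynomial.C (g a) *
    (MvPolynomial.X 0 ^ a.1 * MvPolynomial.X 1 ^ a.2), fun z => ?_⟩
  rw [H2.value, tsum_eq_sum (s := Finset.Iic N) fun a ha => by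
    rw [hg a (by simpa using ha), zero_mul]]
  simp

/-- If the wandering subspace of an invariant subspace `S` consists of quotients of polynomials of
bounded degree by `p`, then the reproducing kernel of `S` is, up to the factor coming from the
shift, a finite sum of such quotients. -/
theorem exists_kernel_eq_sum {S : Submodule ℂ H2} {d : ℕ × ℕ}
    (hinv : ∀ f ∈ S, mulMonomial d f ∈ S) (hp : ∀ z ∈ bidisk, MvPolynomial.eval z p ≠ 0)
    (hE : ∀ f ∈ wandering S d, ∀ a, ¬ a ≤ N → polyOp p f a = 0) :
    ∃ (n : ℕ) (f : Fin n → H2) (F : Fin n → MvPolynomial (Fin 2) ℂ), (∀ i, f i ∈ S) ∧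
      (∀ i, ∀ z ∈ bidisk, MvPolynomial.eval z (F i) =
        MvPolynomial.eval z p * (f i).value z) ∧
      ∀ w, ∀ hw : w ∈ bidisk, ∀ s ∈ S, (∀ f ∈ S, inner ℂ f s = inner ℂ f (kernel w hw)) →
        ∀ z ∈ bidisk, (1 - z 0 ^ d.1 * z 1 ^ d.2 * conj (w 0 ^ d.1 * w 1 ^ d.2)) * s.value z =
          ∑ i, (f i).value z * conj ((f i).value w) := by
  have := finiteDimensional_of_polyOp_apply_eq_zero hp hE
  let b := stdOrthonormalBasis ℂ (wandering S d)
  have hF (i) := exists_eval_eq_value (hE (b i) (b i).2)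
  choose F hF using hF
  refine ⟨_, fun i => (b i : H2), F, fun i => (mem_wandering.1 (b i).2).1,
    fun i z hz => by rw [hF, value_polyOp _ _ hz], fun w hw s hs hsk z hz => ?_⟩
  have hinner (f : H2) (hf : f ∈ S) : inner ℂ f s = conj (f.value w) := by
    rw [hsk f hf, ← inner_conj_symm, inner_kernel_left]
  let e : H2 := s - conj (w 0 ^ d.1 * w 1 ^ d.2) • mulMonomial d s
  have he : e ∈ wandering S d := by
    refine mem_wandering.2 ⟨S.sub_mem hs (S.smul_mem _ (hinv s hs)), fun g hg => ?_⟩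
    rw [inner_sub_right, inner_smul_right, LinearIsometry.inner_map_map, hinner _ (hinv g hg),
      hinner g hg, value_mulMonomial, map_mul, sub_self]
  have hbe (i) : inner ℂ (b i : H2) e = conj ((b i : H2).value w) := by
    have h0 : inner ℂ (b i : H2) (mulMonomial d s) = 0 := by
      rw [← inner_conj_symm, (mem_wandering.1 (b i).2).2 s hs, map_zero]
    rw [inner_sub_right, inner_smul_right, h0, mul_zero, sub_zero,
      hinner _ (mem_wandering.1 (b i).2).1]
  have hsum : e = ∑ i, conj ((b i : H2).value w) • (b i : H2) := by
    have h1 := b.sum_repr' ⟨e, he⟩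
    have h2 := congrArg (fun x : wandering S d => (x : H2)) h1
    simp only [Submodule.coe_sum, Submodule.coe_smul, Submodule.coe_inner, hbe] at h2
    exact h2.symm
  have hval : e.value z = (1 - z 0 ^ d.1 * z 1 ^ d.2 * conj (w 0 ^ d.1 * w 1 ^ d.2)) *
      s.value z := by
    rw [H2.value_sub _ _ hz, H2.value_smul _ _ hz, value_mulMonomial]
    ring
  rw [← hval, hsum, ← inner_kernel_left hz, inner_sum]
  refine Finset.sum_congr rfl fun i _ => ?_
  rw [inner_smul_right, inner_kernel_left, mul_comm]

theorem eq_zero_of_eval_eq_zero_on_bidisk {P : MvPolynomial (Fin 2) ℂ}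
    (hP : ∀ z ∈ bidisk, MvPolynomial.eval z P = 0) : P = 0 := by
  have hinf : (Metric.ball (0 : ℂ) 1).Infinite :=
    (NormedSpace.sphere_nonempty (E := ℂ) (x := 0) (r := 1 / 2)).2 (by norm_num) |>.elim
      fun _ _ => infinite_of_mem_nhds 0 (Metric.ball_mem_nhds 0 one_pos)
  refine MvPolynomial.funext_set (fun _ => Metric.ball (0 : ℂ) 1) (fun _ => hinf) fun z hz => ?_
  rw [hP z fun i => by simpa using hz i (Set.mem_univ i), map_zero]

/-- The Agler decomposition of a rational inner function coming from a shift decomposition. -/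
theorem IsReducedForm.exists_agler (h : IsReducedForm Θ p q N c)
    (hS : IsShiftDecomposition Θ S₁ S₂) :
    ∃ (k l : ℕ) (F : Fin k → MvPolynomial (Fin 2) ℂ) (G : Fin l → MvPolynomial (Fin 2) ℂ)
      (g : Fin l → H2), (∀ j, g j ∈ S₂) ∧
      (∀ j, ∀ z ∈ bidisk, MvPolynomial.eval z (G j) =
        MvPolynomial.eval z p * (g j).value z) ∧
      ∀ z w : Fin 2 → ℂ, MvPolynomial.eval z p * conj (MvPolynomial.eval w p) -
        MvPolynomial.eval z q * conj (MvPolynomial.eval w q) =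
        (1 - z 1 * conj (w 1)) *
          ∑ i, MvPolynomial.eval z (F i) * conj (MvPolynomial.eval w (F i)) +
        (1 - z 0 * conj (w 0)) *
          ∑ j, MvPolynomial.eval z (G j) * conj (MvPolynomial.eval w (G j)) := by
  obtain ⟨k, f, F, hf, hF, hfk⟩ := exists_kernel_eq_sum (d := (1, 0)) hS.invariant₁
    h.eval_ne_zero fun f hf => h.polyOp_apply_of_mem_wandering₁ hS hf
  obtain ⟨l, g, G, hg, hG, hgk⟩ := exists_kernel_eq_sum (d := (0, 1)) hS.invariant₂
    h.eval_ne_zero fun f hf => h.polyOp_apply_of_mem_wandering₂ hS hf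
  refine ⟨k, l, F, G, g, hg, hG, ?_⟩
  have hD : ∀ z ∈ bidisk, ∀ w ∈ bidisk,
      MvPolynomial.eval z p * conj (MvPolynomial.eval w p) -
        MvPolynomial.eval z q * conj (MvPolynomial.eval w q) =
        (1 - z 1 * conj (w 1)) *
          ∑ i, MvPolynomial.eval z (F i) * conj (MvPolynomial.eval w (F i)) +
        (1 - z 0 * conj (w 0)) *
          ∑ j, MvPolynomial.eval z (G j) * conj (MvPolynomial.eval w (G j)) := by
    intro z hz w hw
    obtain ⟨v, hv, hvk, hvz⟩ := h.exists_mem_modelSpace hw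
    rw [← hS.sup_eq] at hv
    obtain ⟨s₁, hs₁, s₂, hs₂, rfl⟩ := Submodule.mem_sup.1 hv
    have e1 := hfk w hw s₁ hs₁ (fun u hu => by
      rw [← hvk u (hS.le₁ hu), inner_add_right,
        Submodule.IsOrtho.inner_eq hS.orthogonal hu hs₂, add_zero]) z hz
    have e2 := hgk w hw s₂ hs₂ (fun u hu => by
      rw [← hvk u (hS.le₂ hu), inner_add_right,
        Submodule.IsOrtho.inner_eq hS.orthogonal.symm hu hs₁, zero_add]) z hz
    have e3 := hvz z hz
    rw [H2.value_add _ _ hz] at e3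
    have e4 := value_kernel hz hw
    simp only [pow_one, pow_zero, mul_one, one_mul] at e1 e2
    have hsumF : ∑ i, MvPolynomial.eval z (F i) * conj (MvPolynomial.eval w (F i)) =
        MvPolynomial.eval z p * conj (MvPolynomial.eval w p) *
          ∑ i, (f i).value z * conj ((f i).value w) := by
      rw [Finset.mul_sum]
      refine Finset.sum_congr rfl fun i _ => ?_
      rw [hF i z hz, hF i w hw, map_mul]
      ring
    have hsumG : ∑ j, MvPolynomial.eval z (G j) * conj (MvPolynomial.eval w (G j)) =
        MvPolynomial.eval z p * conj (MvPolynomial.eval w p) *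
          ∑ j, (g j).value z * conj ((g j).value w) := by
      rw [Finset.mul_sum]
      refine Finset.sum_congr rfl fun i _ => ?_
      rw [hG i z hz, hG i w hw, map_mul]
      ring
    have hqz : MvPolynomial.eval z q = Θ z * MvPolynomial.eval z p := by
      rw [h.eq_div z hz, div_mul_cancel₀ _ (h.eval_ne_zero z hz)]
    have hqw : MvPolynomial.eval w q = Θ w * MvPolynomial.eval w p := by
      rw [h.eq_div w hw, div_mul_cancel₀ _ (h.eval_ne_zero w hw)]
    rw [hsumF, hsumG, ← e1, ← e2, hqz, hqw, map_mul]
    linear_combination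
      (-(MvPolynomial.eval z p * conj (MvPolynomial.eval w p)) * (1 - z 0 * conj (w 0)) *
        (1 - z 1 * conj (w 1))) * e3 - (MvPolynomial.eval z p * conj (MvPolynomial.eval w p)) *
        (1 - Θ z * conj (Θ w)) * e4
  let Q (w : Fin 2 → ℂ) : MvPolynomial (Fin 2) ℂ :=
    p * MvPolynomial.C (conj (MvPolynomial.eval w p)) -
      q * MvPolynomial.C (conj (MvPolynomial.eval w q)) -
      ((1 - MvPolynomial.X 1 * MvPolynomial.C (conj (w 1))) *
        ∑ i, F i * MvPolynomial.C (conj (MvPolynomial.eval w (F i))) +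
      (1 - MvPolynomial.X 0 * MvPolynomial.C (conj (w 0))) *
        ∑ j, G j * MvPolynomial.C (conj (MvPolynomial.eval w (G j))))
  have hQ (z w : Fin 2 → ℂ) : MvPolynomial.eval z (Q w) =
      MvPolynomial.eval z p * conj (MvPolynomial.eval w p) -
        MvPolynomial.eval z q * conj (MvPolynomial.eval w q) -
        ((1 - z 1 * conj (w 1)) *
          ∑ i, MvPolynomial.eval z (F i) * conj (MvPolynomial.eval w (F i)) +
        (1 - z 0 * conj (w 0)) *
          ∑ j, MvPolynomial.eval z (G j) * conj (MvPolynomial.eval w (G j))) := by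
    simp [Q]
  have hQ_conj (z w : Fin 2 → ℂ) :
      MvPolynomial.eval z (Q w) = conj (MvPolynomial.eval w (Q z)) := by
    rw [hQ, hQ]
    simp only [map_sub, map_add, map_mul, map_sum, Complex.conj_conj, map_one]
    simp only [mul_comm (conj _)]
  have h1 : ∀ w ∈ bidisk, Q w = 0 := fun w hw =>
    eq_zero_of_eval_eq_zero_on_bidisk fun z hz => by rw [hQ, hD z hz w hw, sub_self]
  have h2 : ∀ w, Q w = 0 := fun w => eq_zero_of_eval_eq_zero_on_bidisk fun z hz => by
    rw [hQ_conj, h1 z hz, map_zero, map_zero]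
  intro z w
  rw [← sub_eq_zero, ← hQ, h2, map_zero]

end

section

variable {Θ : (Fin 2 → ℂ) → ℂ} {p q : MvPolynomial (Fin 2) ℂ} {N : ℕ × ℕ} {c : ℂ}
  {S₁ S₂ : Submodule ℂ H2}

/-! ### Small numerical radius forces common zeros -/

theorem exists_polynomial_value {m : ℕ} {g : H2} (hg : backShift (m, 0) g = 0) {ζ : ℂ}
    (hζ : ‖ζ‖ < 1) : ∃ P : Polynomial ℂ, ∀ x : ℂ, ‖x‖ < 1 → g.value ![x, ζ] = P.eval x := by
  induction m generalizing g with
  | zero =>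
    have h0 : backShift (0, 0) g = g := by
      ext a
      rw [backShift_apply]
      exact g.apply_congr (by simp) (by simp)
    rw [← h0, hg]
    exact ⟨0, fun x _ => by simp [H2.value]⟩
  | succ m ih =>
    obtain ⟨P, hP⟩ := ih (g := backShift (1, 0) g) (by
      rw [backShift_backShift, Prod.mk_add_mk, add_zero]; exact hg)
    refine ⟨Polynomial.X * P + Polynomial.C (g.value ![0, ζ]), fun x hx => ?_⟩
    have h1 := mul_value_backShift_fst g (z := ![x, ζ]) (bidisk_of_norm_lt hx hζ)
    rw [hP x hx] at h1
    simp only [Matrix.cons_val_zero, Matrix.cons_val_one, Matrix.cons_val_fin_one] at h1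
    simp only [Polynomial.eval_add, Polynomial.eval_mul, Polynomial.eval_X, Polynomial.eval_C]
    rw [h1]
    ring

theorem exists_polynomial_slice (P : MvPolynomial (Fin 2) ℂ) (ζ : ℂ) :
    ∃ R : Polynomial ℂ, ∀ x, R.eval x = MvPolynomial.eval ![x, ζ] P := by
  refine ⟨MvPolynomial.aeval ![Polynomial.X, Polynomial.C ζ] P, fun x => ?_⟩
  rw [eval_aeval]
  congr 2
  ext k
  fin_cases k <;> simp

theorem IsShiftDecomposition.exists_sub_smul_backShift_eq [S₂.HasOrthogonalProjection]
    (hS : IsShiftDecomposition Θ S₁ S₂) {α : ℂ}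
    (hα : ‖α‖ * numericalRadius (compressedShift S₂) < 1) {f : H2} (hf : f ∈ S₂) :
    ∃ f' ∈ S₂, f' - α • backShift (1, 0) f' = f := by
  have : CompleteSpace S₂ := hS.isClosed₂.completeSpace_coe
  let B : S₂ →L[ℂ] S₂ := ((backShift (1, 0)).comp S₂.subtypeL).codRestrict S₂
    fun g => hS.backShift_mem₂ g.2
  let T : S₂ →L[ℂ] S₂ := ContinuousLinearMap.id ℂ S₂ - α • B
  let δ : ℝ := 1 - ‖α‖ * numericalRadius (compressedShift S₂)
  have hδ : 0 < δ := by simp only [δ]; linarith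
  have hT : IsUnit T := by
    refine ContinuousLinearMap.isUnit_of_forall_le_norm_inner_map T (c := ⟨δ, hδ.le⟩) hδ fun g => ?_
    have h1 : inner ℂ (T g) g = inner ℂ g g -
        conj α * inner ℂ (g : H2) (mulMonomial (1, 0) (g : H2)) := by
      rw [← inner_backShift_left, Submodule.coe_inner, Submodule.coe_inner]
      change inner ℂ ((g : H2) - α • backShift (1, 0) (g : H2)) (g : H2) = _
      rw [inner_sub_left, inner_smul_left]
    have h2 := norm_inner_le_numericalRadius S₂ g
    have h3 : ‖inner ℂ g g‖ = ‖g‖ ^ 2 := by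
      rw [Submodule.coe_inner, inner_self_eq_norm_sq_to_K, norm_pow]
      simp
    rw [h1]
    refine le_trans ?_ (norm_sub_norm_le _ _)
    rw [h3, norm_mul, RCLike.norm_conj]
    change ‖g‖ ^ 2 * δ ≤ _
    have h4 := mul_le_mul_of_nonneg_left h2 (norm_nonneg α)
    simp only [δ]
    linarith
  obtain ⟨u, hu⟩ := hT
  refine ⟨((↑u⁻¹ : S₂ →L[ℂ] S₂) ⟨f, hf⟩ : S₂), Subtype.coe_prop _, ?_⟩
  have h1 : T ((↑u⁻¹ : S₂ →L[ℂ] S₂) ⟨f, hf⟩) = ⟨f, hf⟩ := by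
    rw [← hu]
    exact congrArg (fun A : S₂ →L[ℂ] S₂ => A ⟨f, hf⟩) u.mul_inv
  exact congrArg Subtype.val h1

/-- If the numerical radius is less than one, then the functions `p f` with `f ∈ S₂` vanish at
those zeros of `p` that are slightly outside of the bidisk in the first variable. -/
theorem IsReducedForm.eval_eq_zero_of_mem₂ [S₂.HasOrthogonalProjection]
    (h : IsReducedForm Θ p q N c) (hS : IsShiftDecomposition Θ S₁ S₂) {α ζ : ℂ}
    (hα : ‖α‖ * numericalRadius (compressedShift S₂) < 1) (hζ : ‖ζ‖ < 1)
    (hp : MvPolynomial.eval ![α, ζ] p = 0) {f : H2} (hf : f ∈ S₂)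
    {F : MvPolynomial (Fin 2) ℂ} (hF : ∀ z ∈ bidisk, MvPolynomial.eval z F =
      MvPolynomial.eval z p * f.value z) : MvPolynomial.eval ![α, ζ] F = 0 := by
  obtain ⟨f', hf', rfl⟩ := hS.exists_sub_smul_backShift_eq hα hf
  obtain ⟨P, hP⟩ := exists_polynomial_value (h.backShift_polyOp_of_mem₂ hS hf') hζ
  obtain ⟨R, hR⟩ := exists_polynomial_slice p ζ
  obtain ⟨G, hG⟩ := exists_polynomial_slice F ζ
  have hα0 : α ≠ 0 := by
    rintro rfl
    exact h.eval_ne_zero ![0, ζ] (bidisk_of_norm_lt (by simp) hζ) hp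
  have hpoly : (Polynomial.X - Polynomial.C α) * P =
      Polynomial.X * G - Polynomial.C (α * f'.value ![0, ζ]) * R := by
    refine Polynomial.eq_of_infinite_eval_eq _ _
      (((infinite_of_mem_nhds (0 : ℂ) (Metric.ball_mem_nhds 0 one_pos))).mono fun x hx => ?_)
    have hx1 : ‖x‖ < 1 := by simpa using hx
    have hxb : (![x, ζ] : Fin 2 → ℂ) ∈ bidisk := bidisk_of_norm_lt hx1 hζ
    have h1 := hP x hx1
    have h2 := mul_value_backShift_fst f' hxb
    have h3 := hF _ hxb
    rw [value_polyOp _ _ hxb] at h1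
    rw [H2.value_sub _ _ hxb, H2.value_smul _ _ hxb] at h3
    simp only [Matrix.cons_val_zero, Matrix.cons_val_one, Matrix.cons_val_fin_one] at h2
    simp only [Set.mem_ofPred_eq, Polynomial.eval_mul, Polynomial.eval_sub, Polynomial.eval_X,
      Polynomial.eval_C, hR, hG, ← h1, h3]
    linear_combination (α * MvPolynomial.eval ![x, ζ] p) * h2
  have h1 := congrArg (Polynomial.eval α) hpoly
  simp only [Polynomial.eval_mul, Polynomial.eval_sub, Polynomial.eval_X, Polynomial.eval_C,
    sub_self, zero_mul, hR, hG, hp, mul_zero, sub_zero] at h1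
  exact (mul_eq_zero.1 h1.symm).resolve_left hα0

theorem IsReducedForm.numericalRadius_eq_one [S₂.HasOrthogonalProjection]
    (h : IsReducedForm Θ p q N c) (hS : IsShiftDecomposition Θ S₁ S₂) {τ : Fin 2 → ℂ}
    (hτ : τ ∈ torus) (hpτ : MvPolynomial.eval τ p = 0) :
    numericalRadius (compressedShift S₂) = 1 := by
  refine le_antisymm (numericalRadius_le_one S₂) (not_lt.1 fun hlt => ?_)
  have hnonneg := numericalRadius_nonneg S₂
  set ρ := numericalRadius (compressedShift S₂)
  obtain ⟨z, hz0, -, hz1, hpz, hqz⟩ := exists_zero_near h.ne_zero h.isRelPrime h.norm_eval_eq hτ hpτ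
    (ε := 1 - ρ) (by linarith)
  have hzeq : z = ![z 0, z 1] := by ext i; fin_cases i <;> rfl
  have hα : ‖z 0‖ * ρ < 1 := by
    have h1 := norm_add_le (z 0 - τ 0) (τ 0)
    rw [sub_add_cancel, hτ 0] at h1
    nlinarith
  obtain ⟨k, l, F, G, g, hg, hG, hFG⟩ := h.exists_agler hS
  have hG0 (j) : MvPolynomial.eval z (G j) = 0 := by
    rw [hzeq] at hpz ⊢
    exact h.eval_eq_zero_of_mem₂ hS hα hz1 hpz (hg j) (hG j)
  have h1 := hFG z z
  simp only [hpz, hG0, zero_mul, zero_sub, Finset.sum_const_zero, mul_zero, add_zero,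
    Complex.mul_conj] at h1
  have h2 : -Complex.normSq (MvPolynomial.eval z q) =
      (1 - Complex.normSq (z 1)) * ∑ i, Complex.normSq (MvPolynomial.eval z (F i)) := by
    exact_mod_cast h1
  have h3 : 0 ≤ ∑ i, Complex.normSq (MvPolynomial.eval z (F i)) :=
    Finset.sum_nonneg fun i _ => Complex.normSq_nonneg _
  have h4 : 0 ≤ 1 - Complex.normSq (z 1) := by
    rw [Complex.normSq_eq_norm_sq]
    nlinarith [norm_nonneg (z 1)]
  have h5 : 0 < Complex.normSq (MvPolynomial.eval z q) := Complex.normSq_pos.2 hqz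
  have h6 := mul_nonneg h4 h3
  linarith

/-! ### Singularities are zeros of the denominator -/

theorem IsReducedForm.eval_eq_zero_of_hasSingularityAt (h : IsReducedForm Θ p q N c)
    {τ : Fin 2 → ℂ} (hτ : HasSingularityAt Θ τ) : MvPolynomial.eval τ p = 0 := by
  by_contra hp
  refine hτ ⟨fun z => MvPolynomial.eval z q / MvPolynomial.eval z p,
    (AnalyticOnNhd.eval_mvPolynomial q τ (Set.mem_univ _)).div
      (AnalyticOnNhd.eval_mvPolynomial p τ (Set.mem_univ _)) hp, ?_⟩
  filter_upwards [self_mem_nhdsWithin] with z hz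
  exact (h.eq_div z hz).symm

theorem IsReducedForm.hasSingularityAt (h : IsReducedForm Θ p q N c) {τ : Fin 2 → ℂ}
    (hτ : τ ∈ torus) (hpτ : MvPolynomial.eval τ p = 0) : HasSingularityAt Θ τ := by
  rintro ⟨F, hF, hFΘ⟩
  let G : (Fin 2 → ℂ) → ℂ := fun z => F z * MvPolynomial.eval z p - MvPolynomial.eval z q
  have hG : AnalyticAt ℂ G τ :=
    (hF.mul (AnalyticOnNhd.eval_mvPolynomial p τ (Set.mem_univ _))).sub
      (AnalyticOnNhd.eval_mvPolynomial q τ (Set.mem_univ _))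
  obtain ⟨ε₁, hε₁, hball⟩ := hG.exists_ball_analyticOnNhd
  obtain ⟨ε₂, hε₂, hΘ⟩ := Metric.mem_nhdsWithin_iff.1 hFΘ
  let ε := min ε₁ ε₂
  have hε : 0 < ε := lt_min hε₁ hε₂
  have hGε : AnalyticOnNhd ℂ G (Metric.ball τ ε) :=
    hball.mono (Metric.ball_subset_ball (min_le_left _ _))
  have hbd : IsOpen bidisk := by
    have : bidisk = ⋂ i, {z : Fin 2 → ℂ | ‖z i‖ < 1} := by ext; simp [bidisk]
    rw [this]
    exact isOpen_iInter_of_finite fun i => isOpen_lt (by fun_prop) continuous_const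
  have hzero : ∀ z ∈ Metric.ball τ ε ∩ bidisk, G z = 0 := by
    rintro z ⟨hz, hzb⟩
    have h1 : F z = Θ z := hΘ ⟨Metric.ball_subset_ball (min_le_right _ _) hz, hzb⟩
    simp only [G]
    rw [h1, h.eq_div z hzb, div_mul_cancel₀ _ (h.eval_ne_zero z hzb), sub_self]
  obtain ⟨s, hs0, hs⟩ : ∃ s : ℝ, 0 < s ∧ s < min 1 ε := exists_between (lt_min one_pos hε)
  have hs1 := hs.trans_le (min_le_left _ _)
  have hsε := hs.trans_le (min_le_right _ _)
  let z₀ : Fin 2 → ℂ := fun i => ((1 - s : ℝ) : ℂ) * τ i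
  have hz₀b : z₀ ∈ bidisk := fun i => by
    simp only [z₀]
    rw [norm_mul, hτ i, mul_one, Complex.norm_real, Real.norm_eq_abs, abs_lt]
    constructor <;> linarith
  have hz₀ : z₀ ∈ Metric.ball τ ε := by
    rw [Metric.mem_ball, dist_pi_lt_iff hε]
    intro i
    simp only [z₀]
    rw [dist_eq_norm, show ((1 - s : ℝ) : ℂ) * τ i - τ i = ((-s : ℝ) : ℂ) * τ i by
      push_cast; ring, norm_mul, hτ i, mul_one, Complex.norm_real, Real.norm_eq_abs, abs_lt]
    constructor <;> linarith
  have hev : G =ᶠ[𝓝 z₀] 0 :=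
    Filter.eventually_of_mem ((Metric.isOpen_ball.inter hbd).mem_nhds ⟨hz₀, hz₀b⟩) hzero
  have hGzero := hGε.eqOn_zero_of_preconnected_of_eventuallyEq_zero
    (convex_ball τ ε).isPreconnected hz₀ hev
  obtain ⟨z, hz0, hz1, -, hpz, hqz⟩ := exists_zero_near h.ne_zero h.isRelPrime h.norm_eval_eq hτ
    hpτ hε
  have hzε : z ∈ Metric.ball τ ε := by
    rw [Metric.mem_ball, dist_pi_lt_iff hε]
    intro i
    rw [dist_eq_norm]
    fin_cases i
    · exact hz0
    · exact hz1
  have := hGzero hzε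
  simp only [G, hpz, mul_zero, zero_sub, Pi.zero_apply, neg_eq_zero] at this
  exact hqz this

end

end BidiskShift

end

theorem theorem3p6 (Θ : (Fin 2 → ℂ) → ℂ) (m n : ℕ)
    (hinner : BidiskShift.IsInner Θ) (hdeg : BidiskShift.IsRationalOfDegree Θ m n)
    (S₁ S₂ : Submodule ℂ BidiskShift.H2) [S₂.HasOrthogonalProjection]
    (hS : BidiskShift.IsShiftDecomposition Θ S₁ S₂) :
    BidiskShift.numericalRadius (BidiskShift.compressedShift S₂) = 1 ↔
      ∃ τ ∈ BidiskShift.torus, BidiskShift.HasSingularityAt Θ τ := by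
  obtain ⟨p, q, c, h⟩ := BidiskShift.exists_isReducedForm hinner hdeg
  constructor
  · intro hw
    by_contra! hcon
    have hlt := h.numericalRadius_lt_one hS fun z hz hpz =>
      hcon z hz (h.hasSingularityAt hz hpz)
    exact hlt.ne hw
  · rintro ⟨τ, hτ, hsing⟩
    exact h.numericalRadius_eq_one hS hτ (h.eval_eq_zero_of_hasSingularityAt hsing)
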